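/- Let $G$ be a countably infinite discrete amenable group acting by homeomorphisms on a nonempty compact metric space $(X,d)$, and assume that $(X,G)$ is minimal and satisfies the local Bronstein condition: whenever $(x,x')$ is a minimal point of $(X\times X,G)$ (diagonal action) lying in the regionally proximal relation $$RP_2(X,G)=\{(x_1,x_2):\forall\epsilon>0\ \exists x_1',x_2'\in X,\ g\in G:\ d(x_k,x_k')\le\epsilon\ (k=1,2),\ d(gx_1',gx_2')\le\epsilon\},$$ there are minimal points $(x_n,x_n')$ of $(X\times X,G)$ and $g_n\in G$ with $(x_n,x_n')\to(x,x')$ and $d(g_nx_n,g_nx_n')\to0$. (A point is minimal if its orbit closure contains no proper nonempty closed invariant subset.) Let $\pi_{eq}:X\to X_{eq}=X/S_{eq}$ be the maximal equicontinuous factor, where $S_{eq}$ is the smallest closed invariant equivalence relation with equicontinuous quotient, and let $\nu_{eq}$ be the unique invariant Borel probability measure of $(X_{eq},G)$. For $N\in\mathbb N\cup\{\infty\}$, $\pi_{eq}$ is *almost $N$ to one* if $\{y\in X_{eq}:|\pi_{eq}^{-1}(y)|=N\}$ is residual in $X_{eq}$, and *regular $N$ to one* if this set has $\nu_{eq}$-measure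 $1$. A Følner sequence of $G$ is a sequence $(F_n)$ of nonempty finite subsets with $|gF_n\triangle F_n|/|F_n|\to0$ for all $g\in G$, and the upper Banach density of $A\subset G$ is $\overline{BD}(A)=\sup_{(F_n)}\limsup_{n\to\infty}|F_n\cap A|/|F_n|$, the supremum being over all Følner sequences. A tuple $(x_1,\dots,x_K)\in X^K$ is *weakly mean-sensitive* if for all open neighborhoods $U_k$ of $x_k$ there is $\delta>0$ such that $\overline{BD}(\{g\in G: gU\cap U_k\ne\emptyset\text{ for }1\le k\le K\})>\delta$ for every nonempty open $U\subset X$; it is *essential* if the $x_k$ are pairwise distinct. A set is weakly mean-sensitive if every tuple of points of it is. Then: 1. If, for some $K\ge2$, $(X,G)$ has no essential weakly mean-sensitive $K$-tuple, then $\pi_{eq}$ is regular $K'$ to one for some $1\le K'\le K-1$. 2. If $\pi_{eq}$ is open, then $\pi_{eq}^{-1}(y)$ is a weakly mean-sensitive set for every $y\in X_{eq}$. 3. Let $N\in\mathbb N\cup\{\infty\}$ and let $K\in\mathbb N$ with $2\le K\le N$. If $\pi_{eq}$ is almost $N$ to one, then for every $y\in X_{eq}$ the fiber $\pi_{eq}^{-1}(y)$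 contains an essential weakly mean-sensitive $K$-tuple, i.e. there is such a tuple all of whose entries lie in $\pi_{eq}^{-1}(y)$. 4. If, for some $K\ge2$, $(X,G)$ has no essential weakly mean-sensitive $K$-tuple, then $(X,G)$ has at most $K-1$ ergodic invariant Borel probability measures. -/

import Mathlib

open Set Filter Topology MeasureTheory
open scoped Pointwise ENNReal symmDiff

/-! ## Amenability and upper Banach density -/

/-- A (left) Følner sequence of a discrete group: finite nonempty sets `F n` such that
`|g F n ∆ F n| / |F n| → 0` for every `g`. -/
def IsFolnerSeq {G : Type*} [Group G] (F : ℕ → Finset G) : Prop :=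
  (∀ n, (F n).Nonempty) ∧
    ∀ g : G, Tendsto
      (fun n => (((g • (F n : Set G)) ∆ (F n : Set G)).ncard : ℝ) / ((F n).card : ℝ))
      atTop (𝓝 0)

/-- A countable discrete group is amenable if it has a Følner sequence. -/
def IsAmenableGroup (G : Type*) [Group G] : Prop :=
  ∃ F : ℕ → Finset G, IsFolnerSeq F

/-- Upper Banach density: the supremum over all Følner sequences of the upper densities
`limsup |F n ∩ A| / |F n|`. -/
noncomputable def upperBanachDensity {G : Type*} [Group G] (A : Set G) : ℝ≥0∞ :=
  ⨆ (F : ℕ → Finset G) (_ : IsFolnerSeq F),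
    limsup (fun n => ((((F n : Set G) ∩ A).ncard : ℕ) : ℝ≥0∞) / ((F n).card : ℝ≥0∞)) atTop

/-! ## Minimal points, regional proximality, the local Bronstein condition -/

/-- `y` is a minimal point: its orbit closure has no proper nonempty closed invariant subset. -/
def IsMinimalPoint (G : Type*) {Y : Type*} [Group G] [TopologicalSpace Y] [MulAction G Y]
    (y : Y) : Prop :=
  ∀ C : Set Y, C ⊆ closure (MulAction.orbit G y) → IsClosed C → C.Nonempty →
    (∀ g : G, ∀ z ∈ C, g • z ∈ C) → C = closure (MulAction.orbit G y)

/-- The regionally proximal relation `RP₂(X, G)`. -/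
def regionallyProximal (G X : Type*) [Group G] [MetricSpace X] [MulAction G X] : Set (X × X) :=
  {p | ∀ ε : ℝ, 0 < ε → ∃ (x₁ x₂ : X) (g : G),
    dist p.1 x₁ ≤ ε ∧ dist p.2 x₂ ≤ ε ∧ dist (g • x₁) (g • x₂) ≤ ε}

/-- The local Bronstein condition; `X × X` carries the diagonal action. -/
def LocalBronstein (G X : Type*) [Group G] [MetricSpace X] [MulAction G X] : Prop :=
  ∀ p : X × X, IsMinimalPoint G p → p ∈ regionallyProximal G X →
    ∃ (q : ℕ → X × X) (g : ℕ → G),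
      (∀ n, IsMinimalPoint G (q n)) ∧
      Tendsto q atTop (𝓝 p) ∧
      Tendsto (fun n => dist (g n • (q n).1) (g n • (q n).2)) atTop (𝓝 0)

/-! ## The maximal equicontinuous factor -/

/-- Equicontinuity of an action on a compact Hausdorff space, where the neighbourhoods of the
diagonal are exactly the entourages; see `isEquicontinuousSystem_iff` for the `ε`-`δ` form. -/
def IsEquicontinuousSystem (G Y : Type*) [TopologicalSpace Y] [SMul G Y] : Prop :=
  ∀ V ∈ 𝓝ˢ (diagonal Y), ∃ U ∈ 𝓝ˢ (diagonal Y), ∀ p ∈ U, ∀ g : G, (g • p.1, g • p.2) ∈ V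

theorem isEquicontinuousSystem_iff (G Y : Type*) [MetricSpace Y] [CompactSpace Y] [SMul G Y] :
    IsEquicontinuousSystem G Y ↔
      ∀ ε : ℝ, 0 < ε → ∃ δ : ℝ, 0 < δ ∧
        ∀ x y : Y, dist x y < δ → ∀ g : G, dist (g • x) (g • y) < ε := by
  unfold IsEquicontinuousSystem
  rw [nhdsSet_diagonal_eq_uniformity]
  constructor
  · intro h ε hε
    obtain ⟨U, hU, hUV⟩ := h _ (Metric.dist_mem_uniformity hε)
    obtain ⟨δ, hδ, hδU⟩ := Metric.mem_uniformity_dist.1 hU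
    exact ⟨δ, hδ, fun x y hxy g => hUV (x, y) (hδU hxy) g⟩
  · intro h V hV
    obtain ⟨ε, hε, hεV⟩ := Metric.mem_uniformity_dist.1 hV
    obtain ⟨δ, hδ, hδ'⟩ := h ε hε
    exact ⟨_, Metric.dist_mem_uniformity hδ, fun p hp g => hεV (hδ' p.1 p.2 hp g)⟩

/-- The equivalence relation `R` is invariant under the action. -/
def IsInvariantSetoid (G : Type*) {X : Type*} [Group G] [MulAction G X] (R : Setoid X) : Prop :=
  ∀ (g : G) (x y : X), R x y → R (g • x) (g • y)

/-- The action induced on the quotient by an invariant equivalence relation. -/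
@[reducible]
def quotientMulAction {G X : Type*} [Group G] [MulAction G X] (R : Setoid X)
    (hR : IsInvariantSetoid G R) : MulAction G (Quotient R) where
  smul g := Quotient.map (fun x => g • x) (fun x y h => hR g x y h)
  one_smul := by
    rintro ⟨x⟩
    exact congrArg (Quotient.mk R) (one_smul G x)
  mul_smul := by
    rintro g h ⟨x⟩
    exact congrArg (Quotient.mk R) (mul_smul g h x)

/-- `R` is a closed invariant equivalence relation whose quotient system is equicontinuous.
(Closedness says that the quotient of the compact metric space `X` is again a compact
metrizable space.) -/
def HasEquicontinuousQuotient (G : Type*) {X : Type*} [Group G] [TopologicalSpace X]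
    [MulAction G X] (R : Setoid X) : Prop :=
  IsClosed {p : X × X | R p.1 p.2} ∧
    ∃ hR : IsInvariantSetoid G R,
      letI := quotientMulAction R hR
      IsEquicontinuousSystem G (Quotient R)

/-- The equicontinuous structure relation `S_eq`: the smallest closed invariant equivalence
relation with equicontinuous quotient, i.e. the intersection of all of them. -/
def equicontinuousStructureRel (G X : Type*) [Group G] [TopologicalSpace X] [MulAction G X] :
    Setoid X :=
  sInf {R : Setoid X | HasEquicontinuousQuotient G R}

theorem equicontinuousStructureRel_invariant (G X : Type*) [Group G] [TopologicalSpace X]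
    [MulAction G X] : IsInvariantSetoid G (equicontinuousStructureRel G X) := by
  intro g x y h R hR
  exact hR.2.1 g x y (h R hR)

/-- The maximal equicontinuous factor `X_eq = X / S_eq`. -/
def MaxEquicontinuousFactor (G X : Type*) [Group G] [TopologicalSpace X] [MulAction G X] :
    Type _ :=
  Quotient (equicontinuousStructureRel G X)

instance MaxEquicontinuousFactor.instTopologicalSpace (G X : Type*) [Group G]
    [TopologicalSpace X] [MulAction G X] : TopologicalSpace (MaxEquicontinuousFactor G X) :=
  inferInstanceAs (TopologicalSpace (Quotient (equicontinuousStructureRel G X)))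

instance MaxEquicontinuousFactor.instMulAction (G X : Type*) [Group G] [TopologicalSpace X]
    [MulAction G X] : MulAction G (MaxEquicontinuousFactor G X) :=
  quotientMulAction (equicontinuousStructureRel G X) (equicontinuousStructureRel_invariant G X)

instance MaxEquicontinuousFactor.instMeasurableSpace (G X : Type*) [Group G]
    [TopologicalSpace X] [MulAction G X] : MeasurableSpace (MaxEquicontinuousFactor G X) :=
  borel _

instance MaxEquicontinuousFactor.instBorelSpace (G X : Type*) [Group G]
    [TopologicalSpace X] [MulAction G X] : BorelSpace (MaxEquicontinuousFactor G X) :=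
  ⟨rfl⟩

/-- The factor map `π_eq : X → X_eq`. -/
def piEq (G : Type*) {X : Type*} [Group G] [TopologicalSpace X] [MulAction G X] (x : X) :
    MaxEquicontinuousFactor G X :=
  Quotient.mk (equicontinuousStructureRel G X) x

/-- `ν` is the unique invariant Borel probability measure of the system `(Y, G)`. -/
def IsUniqueInvariantProbability (G : Type*) {Y : Type*} [Group G] [MeasurableSpace Y]
    [MulAction G Y] (ν : Measure Y) : Prop :=
  (IsProbabilityMeasure ν ∧ SMulInvariantMeasure G Y ν) ∧
    ∀ ν' : Measure Y, IsProbabilityMeasure ν' → SMulInvariantMeasure G Y ν' → ν' = ν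

/-- `π_eq` is almost `N` to one: the set of points whose fiber has exactly `N` elements
(is infinite, if `N = ∞`) is residual. -/
def PiEqAlmostToOne (G X : Type*) [Group G] [TopologicalSpace X] [MulAction G X]
    (N : ℕ∞) : Prop :=
  {y : MaxEquicontinuousFactor G X | (piEq G ⁻¹' {y} : Set X).encard = N} ∈
    residual (MaxEquicontinuousFactor G X)

/-- `π_eq` is regular `N` to one: `X_eq` has a unique invariant probability measure `ν_eq`, and
`ν_eq`-almost every fiber has exactly `N` elements. -/
def PiEqRegularToOne (G X : Type*) [Group G] [TopologicalSpace X] [MulAction G X]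
    (N : ℕ∞) : Prop :=
  ∃ ν : Measure (MaxEquicontinuousFactor G X), IsUniqueInvariantProbability G ν ∧
    ν {y | (piEq G ⁻¹' {y} : Set X).encard = N} = 1

/-! ## Weakly mean-sensitive tuples and sets -/

/-- `(x₁, …, x_K)` is a weakly mean-sensitive `K`-tuple. -/
def IsWeaklyMeanSensitiveTuple (G : Type*) {X : Type*} [Group G] [TopologicalSpace X]
    [MulAction G X] {K : ℕ} (x : Fin K → X) : Prop :=
  ∀ V : Fin K → Set X, (∀ k, IsOpen (V k) ∧ x k ∈ V k) →
    ∃ δ : ℝ≥0∞, 0 < δ ∧ ∀ U : Set X, IsOpen U → U.Nonempty →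
      δ < upperBanachDensity {g : G | ∀ k, ((g • U) ∩ V k).Nonempty}

/-- An essential weakly mean-sensitive tuple has pairwise distinct entries. -/
def IsEssentialWeaklyMeanSensitiveTuple (G : Type*) {X : Type*} [Group G] [TopologicalSpace X]
    [MulAction G X] {K : ℕ} (x : Fin K → X) : Prop :=
  IsWeaklyMeanSensitiveTuple G x ∧ Function.Injective x

/-- A set all of whose (nonempty finite) tuples are weakly mean-sensitive. -/
def IsWeaklyMeanSensitiveSet (G : Type*) {X : Type*} [Group G] [TopologicalSpace X]
    [MulAction G X] (A : Set X) : Prop :=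
  ∀ (K : ℕ), 1 ≤ K → ∀ x : Fin K → X, (∀ k, x k ∈ A) → IsWeaklyMeanSensitiveTuple G x

/-- The set of ergodic invariant Borel probability measures of `(X, G)`. -/
def ergodicMeasures (G X : Type*) [Group G] [MeasurableSpace X] [MulAction G X] :
    Set (Measure X) :=
  {μ | IsProbabilityMeasure μ ∧ ErgodicSMul G X μ}

/-! ## Følner sequences and invariant measures -/

/-! The engine is McMahon's argument. Amenability gives an invariant probability measure on `X`, and
minimality gives it full support. For a closed invariant `W ⊆ X × Z` and an invariant probability
measure `μ` on the compact metric space `Z`, the function `μ (W_x ∆ W_y)` of the sections is a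
continuous invariant pseudometric on `X`, so it vanishes on `S_eq`. If `μ` has full support, an open
set contained in one section is contained in every section over an equivalent point
(`subset_section_of_rel`). Applying this one coordinate at a time shows that every finite tuple in a
single fiber of `π_eq` can be approximated by tuples inside one translate of any prescribed nonempty
open `U` (`exists_smul_mem_of_fiber`).

This yields a measure criterion for weak mean-sensitivity. Suppose that all neighborhoods `V_k` of
the `x_k` satisfy `ν_eq (⋂ π_eq(V_k)) > 0`. Averaging over a Følner set `F` gives a point `y` and a
proportionate subset `E ⊆ F` whose elements send `y` into the intersection. For `g ∈ E` and each
`k`, some point of the fiber over `y` is sent by `g` into `V_k`. All these points form one finite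
tuple in one fiber, so a single `h` makes `ghU` meet every `V_k` for every `g ∈ E`. Right translates
of Følner sets are Følner, and the resulting density bound does not depend on `U`
(`isWeaklyMeanSensitiveTuple_of_measure_ne_zero`).

By compactness, a compact set of tuples that meets the fibers over a set of positive `ν_eq`-measure
contains a weakly mean-sensitive tuple. The four parts differ only in this compact set: separated
tuples for 1, tuples in fibers near a given one for 3, products of disjoint compact sets carrying
most of the ergodic measures for 4. Openness of `π_eq` gives the criterion directly for 2. -/

theorem IsFolnerSeq.mul_right {G : Type*} [Group G] [DecidableEq G] {F : ℕ → Finset G}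
    (hF : IsFolnerSeq F) (h : ℕ → G) : IsFolnerSeq fun n => (F n).image (· * h n) := by
  refine ⟨fun n => (hF.1 n).image _, fun g => ?_⟩
  refine (hF.2 g).congr fun n => ?_
  have hinj : Function.Injective (· * h n) := mul_left_injective (h n)
  rw [Finset.card_image_of_injective _ hinj, Finset.coe_image]
  congr 2
  rw [← ncard_image_of_injective _ hinj, image_symmDiff hinj]
  congr 2
  ext x
  simp only [mem_smul_set, smul_eq_mul, mem_image, SetLike.mem_coe]
  constructor
  · rintro ⟨_, ⟨y, hy, rfl⟩, rfl⟩
    exact ⟨y * h n, ⟨y, hy, rfl⟩, (mul_assoc _ _ _).symm⟩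
  · rintro ⟨_, ⟨y, hy, rfl⟩, rfl⟩
    exact ⟨g * y, ⟨y, hy, rfl⟩, mul_assoc _ _ _⟩

theorem abs_sum_smul_sub_sum_le {G : Type*} [Group G] (F : Finset G) (k : G) (φ : G → ℝ) (C : ℝ)
    (hφ : ∀ g, |φ g| ≤ C) :
    |∑ g ∈ F, φ (k * g) - ∑ g ∈ F, φ g| ≤ C * (((k • (F : Set G)) ∆ (F : Set G)).ncard : ℝ) := by
  classical
  have h1 : ∑ g ∈ F, φ (k * g) = ∑ g ∈ F.image (k * ·), φ g := by
    rw [Finset.sum_image (fun a _ b _ hab => mul_left_cancel hab)]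
  have h2 : ((k • (F : Set G)) ∆ (F : Set G)) = ((F.image (k * ·) ∆ F : Finset G) : Set G) := by
    rw [Finset.coe_symmDiff, Finset.coe_image]
    rfl
  rw [h1, h2, ncard_coe_finset]
  set A := F.image (k * ·)
  have h3 : ∑ g ∈ A, φ g - ∑ g ∈ F, φ g = ∑ g ∈ A \ F, φ g - ∑ g ∈ F \ A, φ g := by
    rw [Finset.sum_sdiff_sub_sum_sdiff]
  have h4 : (A ∆ F).card = (A \ F).card + (F \ A).card := by
    rw [symmDiff_def]
    exact Finset.card_union_of_disjoint disjoint_sdiff_sdiff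
  have h5 : ∀ S : Finset G, |∑ g ∈ S, φ g| ≤ C * S.card := fun S => by
    refine (Finset.abs_sum_le_sum_abs _ _).trans ((Finset.sum_le_card_nsmul _ _ C
      fun g _ => hφ g).trans ?_)
    rw [nsmul_eq_mul, mul_comm]
  rw [h3, h4]
  push_cast
  calc _ ≤ |∑ g ∈ A \ F, φ g| + |∑ g ∈ F \ A, φ g| := abs_sub _ _
    _ ≤ _ := by linarith [h5 (A \ F), h5 (F \ A)]

theorem IsFolnerSeq.tendsto_average_sub {G : Type*} [Group G] {F : ℕ → Finset G}
    (hF : IsFolnerSeq F) (k : G) {C : ℝ} :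
    Tendsto (fun n => C * ((((k • (F n : Set G)) ∆ (F n : Set G)).ncard : ℝ) / (F n).card))
      atTop (𝓝 0) := by
  simpa using (hF.2 k).const_mul C

theorem abs_average_smul_sub_le {G : Type*} [Group G] (F : Finset G) (k : G)
    (φ : G → ℝ) (C : ℝ) (hφ : ∀ g, |φ g| ≤ C) :
    |(F.card : ℝ)⁻¹ * ∑ g ∈ F, φ (k * g) - (F.card : ℝ)⁻¹ * ∑ g ∈ F, φ g| ≤
      C * ((((k • (F : Set G)) ∆ (F : Set G)).ncard : ℝ) / F.card) := by
  rw [← mul_sub, abs_mul, abs_of_nonneg (by positivity : (0 : ℝ) ≤ (F.card : ℝ)⁻¹),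
    div_eq_inv_mul, mul_left_comm]
  exact mul_le_mul_of_nonneg_left (abs_sum_smul_sub_sum_le F k φ C hφ) (by positivity)

/-- Weak limits of the averages of point masses along a Følner sequence are invariant. -/
theorem exists_invariant_probability {G X : Type*} [Group G] [MetricSpace X]
    [CompactSpace X] [Nonempty X] [MeasurableSpace X] [BorelSpace X] [MulAction G X]
    [ContinuousConstSMul G X] (hG : IsAmenableGroup G) :
    ∃ μ : Measure X, IsProbabilityMeasure μ ∧ SMulInvariantMeasure G X μ := by
  obtain ⟨F, hF⟩ := hG
  obtain ⟨x⟩ := ‹Nonempty X›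
  have hcard : ∀ n, ((F n).card : ℝ≥0∞) ≠ 0 := fun n => by
    simpa using (hF.1 n).ne_empty
  let m : ℕ → Measure X := fun n => ((F n).card : ℝ≥0∞)⁻¹ • ∑ g ∈ F n, Measure.dirac (g • x)
  have hm : ∀ n, IsProbabilityMeasure (m n) := fun n => ⟨by
    simp [m, ENNReal.inv_mul_cancel (hcard n) (ENNReal.natCast_ne_top _)]⟩
  have hint : ∀ n (f : BoundedContinuousFunction X ℝ),
      ∫ y, f y ∂(m n) = ((F n).card : ℝ)⁻¹ * ∑ g ∈ F n, f (g • x) := fun n f => by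
    simp only [m]
    rw [integral_smul_measure, integral_finsetSum_measure]
    · simp
    · intro g _
      exact f.integrable _
  let M : ℕ → ProbabilityMeasure X := fun n => ⟨m n, hm n⟩
  let u : Ultrafilter ℕ := Ultrafilter.of atTop
  have hu : (u : Filter ℕ) ≤ atTop := Ultrafilter.of_le atTop
  obtain ⟨μ, -, hμ⟩ := isCompact_univ.ultrafilter_le_nhds' (u.map M) univ_mem
  have hμ' : Tendsto M u (𝓝 μ) := hμ
  rw [ProbabilityMeasure.tendsto_iff_forall_integral_tendsto] at hμ'
  refine ⟨μ, inferInstance, ⟨fun k s hs => ?_⟩⟩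
  have key : Measure.map (k • ·) (μ : Measure X) = μ := by
    have hmk : Measurable fun y : X => k • y := (continuous_const_smul k).measurable
    have : IsProbabilityMeasure (Measure.map (k • ·) (μ : Measure X)) :=
      Measure.isProbabilityMeasure_map hmk.aemeasurable
    refine ext_of_forall_integral_eq_of_IsFiniteMeasure fun f => ?_
    rw [integral_map hmk.aemeasurable f.continuous.aestronglyMeasurable]
    let f' : BoundedContinuousFunction X ℝ :=
      f.compContinuous ⟨fun y => k • y, continuous_const_smul k⟩
    have h1 := (hμ' f').sub (hμ' f)
    have h2 : Tendsto (fun n => ∫ y, f' y ∂(M n : Measure X) - ∫ y, f y ∂(M n : Measure X))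
        u (𝓝 0) := by
      refine squeeze_zero_norm (fun n => ?_)
        ((hF.tendsto_average_sub k (C := ‖f‖)).mono_left hu)
      have := abs_average_smul_sub_le (F n) k (fun g => f (g • x)) ‖f‖
        fun g => f.norm_coe_le_norm _
      rw [Real.norm_eq_abs]
      change |∫ y, f' y ∂(m n) - ∫ y, f y ∂(m n)| ≤ _
      rw [hint, hint]
      simpa [f', mul_smul] using this
    exact sub_eq_zero.1 (tendsto_nhds_unique h1 h2)
  conv_rhs => rw [← key]
  rw [Measure.map_apply (continuous_const_smul k).measurable hs]

/-- The averages of `f` have the same integral as `f` for every invariant measure. Isometry makes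
them equicontinuous, and the Følner property makes them almost invariant, so by minimality some
average is within `ε` of a constant. -/
theorem invariant_probability_unique {G Y : Type*} [Group G] [MetricSpace Y]
    [CompactSpace Y] [MeasurableSpace Y] [BorelSpace Y] [MulAction G Y]
    [MulAction.IsMinimal G Y] (hG : IsAmenableGroup G)
    (hd : ∀ (g : G) (a b : Y), dist (g • a) (g • b) = dist a b)
    (μ ν : Measure Y) [IsProbabilityMeasure μ] [IsProbabilityMeasure ν]
    [SMulInvariantMeasure G Y μ] [SMulInvariantMeasure G Y ν] : μ = ν := by
  have : ContinuousConstSMul G Y :=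
    ⟨fun g => (Isometry.of_dist_eq (hd g)).continuous⟩
  obtain ⟨F, hF⟩ := hG
  have hcard : ∀ n, ((F n).card : ℝ) ≠ 0 := fun n => by
    simpa using (hF.1 n).ne_empty
  refine ext_of_forall_integral_eq_of_IsFiniteMeasure fun f => ?_
  -- The inverse turns `y ↦ h • y` into left multiplication of the index by `h⁻¹`, which is what a
  -- left Følner sequence controls.
  let A : ℕ → Y → ℝ := fun n y => ((F n).card : ℝ)⁻¹ * ∑ g ∈ F n, f (g⁻¹ • y)
  have hAc : ∀ n, Continuous (A n) := fun n => by
    refine continuous_const.mul (continuous_finsetSum _ fun g _ => ?_)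
    exact f.continuous.comp (continuous_const_smul _)
  have hAi : ∀ n (m : Measure Y) [IsProbabilityMeasure m] [SMulInvariantMeasure G Y m],
      ∫ y, A n y ∂m = ∫ y, f y ∂m := by
    intro n m _ _
    simp only [A]
    rw [integral_const_mul, integral_finsetSum]
    · have : ∀ g ∈ F n, ∫ y, f (g⁻¹ • y) ∂m = ∫ y, f y ∂m := fun g _ => by
        rw [integral_smul_eq_self]
      rw [Finset.sum_congr rfl this, Finset.sum_const, nsmul_eq_mul, inv_mul_cancel_left₀ (hcard n)]
    · intro g _
      exact (f.compContinuous ⟨fun y => g⁻¹ • y, continuous_const_smul _⟩).integrable m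
  have hosc : ∀ ε > 0, ∃ n, ∃ c, ∀ y, |A n y - c| ≤ ε := by
    intro ε hε
    have huc : UniformContinuous f := CompactSpace.uniformContinuous_of_continuous f.continuous
    obtain ⟨δ, hδ, hfδ⟩ := Metric.uniformContinuous_iff.1 huc (ε / 2) (half_pos hε)
    have hclose : ∀ n a b, dist a b < δ → |A n a - A n b| ≤ ε / 2 := by
      intro n a b hab
      simp only [A]
      rw [← mul_sub, ← Finset.sum_sub_distrib, abs_mul,
        abs_of_nonneg (by positivity : (0 : ℝ) ≤ ((F n).card : ℝ)⁻¹)]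
      calc _ ≤ ((F n).card : ℝ)⁻¹ * ((F n).card • (ε / 2)) := by
            refine mul_le_mul_of_nonneg_left ?_ (by positivity)
            refine (Finset.abs_sum_le_sum_abs _ _).trans (Finset.sum_le_card_nsmul _ _ _ ?_)
            intro g _
            exact (hfδ (by rw [hd]; exact hab)).le
        _ = ε / 2 := by rw [nsmul_eq_mul, inv_mul_cancel_left₀ (hcard n)]
    have ⟨y₀⟩ : Nonempty Y := nonempty_of_isProbabilityMeasure μ
    obtain ⟨I, hI⟩ := (isCompact_univ (X := Y)).exists_finite_cover_smul G
      (Metric.isOpen_ball (x := y₀) (ε := δ)) ⟨y₀, Metric.mem_ball_self hδ⟩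
    have hsmall : ∀ᶠ n in atTop, ∀ g ∈ I, ‖f‖ *
        ((((g⁻¹ • (F n : Set G)) ∆ (F n : Set G)).ncard : ℝ) / (F n).card) < ε / 2 := by
      rw [Filter.eventually_all_finset]
      intro g _
      exact (hF.tendsto_average_sub g⁻¹).eventually_lt_const (half_pos hε)
    obtain ⟨n, hn⟩ := hsmall.exists
    refine ⟨n, A n y₀, fun y => ?_⟩
    obtain ⟨g, hg, b, hb, rfl⟩ := mem_iUnion₂.1 (hI (mem_univ y))
    have h1 : |A n (g • b) - A n b| ≤ ε / 2 := by
      have := abs_average_smul_sub_le (F n) g⁻¹ (fun h => f (h⁻¹ • b)) ‖f‖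
        fun h => f.norm_coe_le_norm _
      simp only [mul_inv_rev, inv_inv, mul_smul] at this
      exact this.trans (hn g hg).le
    calc |A n (g • b) - A n y₀| ≤ |A n (g • b) - A n b| + |A n b - A n y₀| := abs_sub_le _ _ _
      _ ≤ ε := by linarith [hclose n b y₀ hb]
  refine eq_of_forall_dist_le fun ε hε => ?_
  obtain ⟨n, c, hc⟩ := hosc (ε / 2) (half_pos hε)
  have hm : ∀ (m : Measure Y) [IsProbabilityMeasure m] [SMulInvariantMeasure G Y m],
      dist (∫ y, f y ∂m) c ≤ ε / 2 := by
    intro m _ _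
    rw [← hAi n m, Real.dist_eq]
    have hA : Integrable (A n) m := (BoundedContinuousFunction.mkOfCompact ⟨A n, hAc n⟩).integrable m
    have h1 : ∫ y, A n y ∂m - c = ∫ y, (A n y - c) ∂m := by
      rw [integral_sub hA (integrable_const c)]
      simp
    rw [h1]
    simpa using norm_integral_le_of_norm_le_const (μ := m) (f := fun y => A n y - c)
      (Eventually.of_forall hc)
  calc _ ≤ dist (∫ y, f y ∂μ) c + dist (∫ y, f y ∂ν) c := dist_triangle_right _ _ _
    _ ≤ ε := by linarith [hm μ, hm ν]

/-! ## Invariant pseudometrics and the maximal equicontinuous factor -/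

theorem isClosedMap_quotientMk {X : Type*} [TopologicalSpace X] [CompactSpace X] [T2Space X]
    {R : Setoid X} (hR : IsClosed {p : X × X | R p.1 p.2}) :
    IsClosedMap (Quotient.mk R) := by
  intro C hC
  rw [← isQuotientMap_quotient_mk'.isClosed_preimage]
  have : Quotient.mk R ⁻¹' (Quotient.mk R '' C) =
      Prod.snd '' ({p : X × X | R p.1 p.2} ∩ Prod.fst ⁻¹' C) := by
    ext x
    constructor
    · rintro ⟨c, hc, h⟩
      exact ⟨(c, x), ⟨Quotient.exact h, hc⟩, rfl⟩
    · rintro ⟨⟨c, x'⟩, ⟨h, hc⟩, rfl⟩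
      exact ⟨c, hc, Quotient.sound h⟩
  change IsClosed (Quotient.mk R ⁻¹' (Quotient.mk R '' C))
  rw [this]
  exact ((hR.inter (hC.preimage continuous_fst)).isCompact.image continuous_snd).isClosed

theorem t2Space_quotient_of_isClosed {X : Type*} [TopologicalSpace X] [CompactSpace X] [T2Space X]
    {R : Setoid X} (hR : IsClosed {p : X × X | R p.1 p.2}) : T2Space (Quotient R) := by
  have hmk := isClosedMap_quotientMk hR
  have hcont : Continuous (Quotient.mk R) := continuous_quotient_mk'
  have hfib : ∀ a : X, IsClosed (Quotient.mk R ⁻¹' {Quotient.mk R a}) := fun a => by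
    have := (hmk {a} isClosed_singleton).preimage hcont
    simpa using this
  refine ⟨fun a b hab => ?_⟩
  obtain ⟨a, rfl⟩ := Quotient.exists_rep a
  obtain ⟨b, rfl⟩ := Quotient.exists_rep b
  have hdisj : Disjoint (Quotient.mk R ⁻¹' {Quotient.mk R a}) (Quotient.mk R ⁻¹' {Quotient.mk R b}) :=
    Disjoint.preimage _ (disjoint_singleton.2 hab)
  obtain ⟨U, V, hU, hV, haU, hbV, hUV⟩ := normal_separation (hfib a) (hfib b) hdisj
  refine ⟨(Quotient.mk R '' Uᶜ)ᶜ, (Quotient.mk R '' Vᶜ)ᶜ, (hmk _ hU.isClosed_compl).isOpen_compl,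
    (hmk _ hV.isClosed_compl).isOpen_compl, ?_, ?_, ?_⟩
  · rintro ⟨x, hx, hxa⟩
    exact hx (haU hxa)
  · rintro ⟨x, hx, hxa⟩
    exact hx (hbV hxa)
  · rw [Set.disjoint_left]
    intro q hq hq'
    obtain ⟨x, rfl⟩ := Quotient.exists_rep q
    have h1 : x ∈ U := by_contra fun h => hq ⟨x, h, rfl⟩
    have h2 : x ∈ V := by_contra fun h => hq' ⟨x, h, rfl⟩
    exact Set.disjoint_left.1 hUV h1 h2

/-- `ρ` is a continuous pseudometric on `X` that is invariant under the action of `G`. -/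
structure IsInvariantPseudometric (G : Type*) {X : Type*} [TopologicalSpace X] [SMul G X]
    (ρ : X → X → ℝ) : Prop where
  self : ∀ x, ρ x x = 0
  symm : ∀ x y, ρ x y = ρ y x
  triangle : ∀ x y z, ρ x z ≤ ρ x y + ρ y z
  smul : ∀ (g : G) x y, ρ (g • x) (g • y) = ρ x y
  eventually_lt : ∀ x, ∀ ε > 0, ∀ᶠ y in 𝓝 x, ρ x y < ε

namespace IsInvariantPseudometric

variable {G X : Type*} [TopologicalSpace X] [SMul G X] {ρ : X → X → ℝ}

theorem nonneg (hρ : IsInvariantPseudometric G ρ) (x y : X) : 0 ≤ ρ x y := by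
  have := hρ.triangle x y x
  rw [hρ.self, hρ.symm y x] at this
  linarith

theorem continuous (hρ : IsInvariantPseudometric G ρ) :
    Continuous fun p : X × X => ρ p.1 p.2 := by
  rw [continuous_iff_continuousAt]
  rintro ⟨a, b⟩
  rw [ContinuousAt, Metric.tendsto_nhds]
  intro ε hε
  rw [nhds_prod_eq]
  filter_upwards [(hρ.eventually_lt a (ε / 2) (half_pos hε)).prod_mk
    (hρ.eventually_lt b (ε / 2) (half_pos hε))] with p hp
  rw [Real.dist_eq, abs_lt]
  have h1 := hρ.triangle p.1 a p.2
  have h2 := hρ.triangle a b p.2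
  have h3 := hρ.triangle a p.1 b
  have h4 := hρ.triangle p.1 p.2 b
  rw [hρ.symm p.1 a] at h1
  rw [hρ.symm p.2 b] at h4
  constructor <;> linarith [hp.1, hp.2]

theorem coinduced_eq_of_dist_eq [CompactSpace X] (hρ : IsInvariantPseudometric G ρ)
    {Y : Type*} [MetricSpace Y] {f : X → Y} (hf : Function.Surjective f)
    (hd : ∀ a b, dist (f a) (f b) = ρ a b) :
    TopologicalSpace.coinduced f ‹TopologicalSpace X› = UniformSpace.toTopologicalSpace := by
  have hc : Continuous f := by
    rw [continuous_iff_continuousAt]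
    intro x
    rw [ContinuousAt, Metric.tendsto_nhds]
    intro ε hε
    filter_upwards [hρ.eventually_lt x ε hε] with y hy
    rw [dist_comm, hd]
    exact hy
  exact (hc.isClosedMap.isQuotientMap hc hf).isCoinducing.eq_coinduced.symm

theorem exists_metricSpace_quotient [CompactSpace X] (hρ : IsInvariantPseudometric G ρ)
    (R : Setoid X) (hR : ∀ x y, R x y ↔ ρ x y = 0) :
    ∃ m : MetricSpace (Quotient R),
      (instTopologicalSpaceQuotient : TopologicalSpace (Quotient R)) =
        m.toPseudoMetricSpace.toUniformSpace.toTopologicalSpace ∧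
      ∀ a b : X, m.dist (Quotient.mk R a) (Quotient.mk R b) = ρ a b := by
  have hle : ∀ a b c d, R a c → R b d → ρ a b ≤ ρ c d := fun a b c d h1 h2 => by
    have e1 := hρ.triangle a c b
    have e2 := hρ.triangle c d b
    rw [(hR _ _).1 h1] at e1
    rw [hρ.symm d b, (hR _ _).1 h2] at e2
    linarith
  have hwd : ∀ a b c d, R a c → R b d → ρ a b = ρ c d := fun a b c d h1 h2 =>
    le_antisymm (hle a b c d h1 h2) (hle c d a b (R.symm h1) (R.symm h2))
  let D : Quotient R → Quotient R → ℝ := Quotient.lift₂ ρ hwd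
  have hD1 : ∀ x, D x x = 0 := by rintro ⟨x⟩; exact hρ.self x
  have hD2 : ∀ x y, D x y = D y x := by rintro ⟨x⟩ ⟨y⟩; exact hρ.symm x y
  have hD3 : ∀ x y z, D x z ≤ D x y + D y z := by
    rintro ⟨x⟩ ⟨y⟩ ⟨z⟩; exact hρ.triangle x y z
  have hD4 : ∀ x y, D x y = 0 → x = y := by
    rintro ⟨x⟩ ⟨y⟩ h
    exact Quotient.sound ((hR x y).2 h)
  obtain ⟨m, hm⟩ : ∃ m : MetricSpace (Quotient R), ∀ a b, m.dist a b = D a b :=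
    ⟨{  dist := D
        dist_self := hD1
        dist_comm := hD2
        dist_triangle := hD3
        eq_of_dist_eq_zero := fun {x y} h => hD4 x y h }, fun _ _ => rfl⟩
  refine ⟨m, ?_, fun a b => hm _ _⟩
  exact @coinduced_eq_of_dist_eq _ _ _ _ _ _ hρ _ m _ Quotient.mk_surjective
    fun a b => hm _ _

end IsInvariantPseudometric

theorem IsInvariantPseudometric.hasEquicontinuousQuotient {G X : Type*} [TopologicalSpace X]
    [CompactSpace X] [Group G] [MulAction G X] {ρ : X → X → ℝ}
    (hρ : IsInvariantPseudometric G ρ) (R : Setoid X) (hR : ∀ x y, R x y ↔ ρ x y = 0) :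
    HasEquicontinuousQuotient G R := by
  refine ⟨?_, fun g x y h => ?_, ?_⟩
  · simp only [hR]
    exact isClosed_eq hρ.continuous continuous_const
  · rw [hR] at h ⊢
    rw [hρ.smul, h]
  · obtain ⟨m, hm, hd⟩ := hρ.exists_metricSpace_quotient R hR
    have hinv : IsInvariantSetoid G R := fun g x y h => by
      rw [hR] at h ⊢
      rw [hρ.smul, h]
    let := quotientMulAction R hinv
    let := m.replaceTopology hm
    change IsEquicontinuousSystem G (Quotient R)
    rw [isEquicontinuousSystem_iff]
    intro ε hε
    refine ⟨ε, hε, ?_⟩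
    rintro ⟨x⟩ ⟨y⟩ hxy g
    exact (((hd _ _).trans (hρ.smul g x y)).trans (hd x y).symm).trans_lt hxy

/-- Take a Urysohn function separating the two classes and the supremum over the group of its
differences; equicontinuity of the quotient makes this supremum continuous. -/
theorem HasEquicontinuousQuotient.exists_pseudometric {G X : Type*} [TopologicalSpace X]
    [CompactSpace X] [T2Space X] [Group G] [MulAction G X] [ContinuousConstSMul G X]
    {R : Setoid X} (hR : HasEquicontinuousQuotient G R) {a b : X} (hab : ¬ R a b) :
    ∃ ρ : X → X → ℝ, IsInvariantPseudometric G ρ ∧ ρ a b ≠ 0 := by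
  obtain ⟨hcl, hinv, heq⟩ := hR
  have := t2Space_quotient_of_isClosed hcl
  let := quotientMulAction R hinv
  have hne : (Quotient.mk R a) ≠ Quotient.mk R b := fun h => hab (Quotient.exact h)
  obtain ⟨f, hfa, hfb, hf⟩ := exists_continuous_zero_one_of_isClosed
    (isClosed_singleton (x := Quotient.mk R a)) (isClosed_singleton (x := Quotient.mk R b))
    (disjoint_singleton.2 hne)
  let F : X → ℝ := fun x => f (Quotient.mk R x)
  have hF : ∀ x y, |F x - F y| ≤ 1 := fun x y => by
    have h1 := hf (Quotient.mk R x)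
    have h2 := hf (Quotient.mk R y)
    rw [abs_le]
    constructor <;> linarith [h1.1, h1.2, h2.1, h2.2]
  have hbdd : ∀ x y, BddAbove (range fun g : G => |F (g • x) - F (g • y)|) := fun x y =>
    ⟨1, by rintro _ ⟨g, rfl⟩; exact hF _ _⟩
  refine ⟨fun x y => ⨆ g : G, |F (g • x) - F (g • y)|, ⟨?_, ?_, ?_, ?_, ?_⟩, ?_⟩
  · intro x
    simp
  · intro x y
    simp only [abs_sub_comm]
  · intro x y z
    refine ciSup_le fun g => (abs_sub_le _ (F (g • y)) _).trans ?_
    exact add_le_add (le_ciSup (hbdd x y) g) (le_ciSup (hbdd y z) g)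
  · intro h x y
    simp only [smul_smul]
    exact (Equiv.mulRight h).surjective.iSup_comp fun g : G => |F (g • x) - F (g • y)|
  · intro x ε hε
    let V : Set (Quotient R × Quotient R) := {p | |f p.1 - f p.2| < ε / 2}
    have hV : V ∈ 𝓝ˢ (diagonal (Quotient R)) := by
      refine IsOpen.mem_nhdsSet (isOpen_lt (by fun_prop) continuous_const) |>.2 ?_
      rintro ⟨p, q⟩ (rfl : p = q)
      simpa [V] using hε
    obtain ⟨U, hU, hUV⟩ := heq V hV
    have hxU : U ∈ 𝓝 (Quotient.mk R x, Quotient.mk R x) := mem_nhdsSet_iff_forall.1 hU _ rfl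
    have hc : Continuous fun y : X => (Quotient.mk R x, Quotient.mk R y) :=
      continuous_const.prodMk continuous_quotient_mk'
    filter_upwards [hc.continuousAt.preimage_mem_nhds hxU] with y hy
    refine (ciSup_le fun g => ?_ : _ ≤ ε / 2).trans_lt (half_lt_self hε)
    exact (hUV _ hy g).le
  · have h1 : |F ((1 : G) • a) - F ((1 : G) • b)| = 1 := by
      have e1 : F a = 0 := hfa rfl
      have e2 : F b = 1 := hfb rfl
      rw [one_smul, one_smul, e1, e2]
      norm_num
    have h2 := le_ciSup (hbdd a b) 1
    rw [h1] at h2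
    exact (zero_lt_one.trans_le h2).ne'

/-- The zero set of the pseudometric is itself a closed invariant relation with isometric, hence
equicontinuous, quotient, so it contains `S_eq`. -/
theorem IsInvariantPseudometric.eq_zero_of_rel {G X : Type*} [TopologicalSpace X]
    [CompactSpace X] [Group G] [MulAction G X] {ρ : X → X → ℝ}
    (hρ : IsInvariantPseudometric G ρ) {x y : X} (h : equicontinuousStructureRel G X x y) :
    ρ x y = 0 := by
  let R : Setoid X :=
    { r := fun x y => ρ x y = 0
      iseqv := ⟨hρ.self, fun {x y} h => by rw [hρ.symm, h], fun {x y z} h1 h2 =>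
        le_antisymm (by have := hρ.triangle x y z; rw [h1, h2] at this; linarith)
          (hρ.nonneg _ _)⟩ }
  exact h R (hρ.hasEquicontinuousQuotient R fun _ _ => Iff.rfl)

/-- By second countability of `X × X`, countably many invariant pseudometrics already separate all
inequivalent pairs; sum their truncations with geometric weights. The result descends to a
compatible invariant metric on `X_eq`. -/
theorem exists_pseudometric_equicontinuousStructureRel (G X : Type*) [Group G] [MetricSpace X]
    [CompactSpace X] [MulAction G X] [ContinuousConstSMul G X] :
    ∃ ρ : X → X → ℝ, IsInvariantPseudometric G ρ ∧
      ∀ x y, equicontinuousStructureRel G X x y ↔ ρ x y = 0 := by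
  obtain ⟨T, hT, hTU⟩ := TopologicalSpace.isOpen_iUnion_countable
    (fun ρ : {ρ : X → X → ℝ // IsInvariantPseudometric G ρ} => {p : X × X | ρ.1 p.1 p.2 ≠ 0})
    fun ρ => isOpen_ne_fun ρ.2.continuous continuous_const
  have hzero : IsInvariantPseudometric G (fun _ _ : X => (0 : ℝ)) :=
    ⟨fun _ => rfl, fun _ _ => rfl, fun _ _ _ => by simp, fun _ _ _ => rfl,
      fun _ _ hε => Eventually.of_forall fun _ => hε⟩
  -- The zero pseudometric only ensures that the countable family is nonempty and can be enumerated
  -- by `ℕ`.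
  obtain ⟨r, hr⟩ := (hT.insert ⟨_, hzero⟩).exists_eq_range (insert_nonempty _ _)
  have hsep : ∀ x y, ¬ equicontinuousStructureRel G X x y → ∃ n, (r n).1 x y ≠ 0 := by
    intro x y hxy
    obtain ⟨R, hR, hRxy⟩ : ∃ R : Setoid X, HasEquicontinuousQuotient G R ∧ ¬ R x y := by
      by_contra! hcon
      exact hxy fun R hR => hcon R hR
    obtain ⟨ρ, hρ, hρxy⟩ := hR.exists_pseudometric hRxy
    have : (x, y) ∈ ⋃ ρ ∈ T, {p : X × X | ρ.1 p.1 p.2 ≠ 0} := by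
      rw [hTU]
      exact mem_iUnion.2 ⟨⟨ρ, hρ⟩, hρxy⟩
    obtain ⟨σ, hσ, hσxy⟩ := mem_iUnion₂.1 this
    obtain ⟨n, rfl⟩ : σ ∈ range r := hr ▸ mem_insert_of_mem _ hσ
    exact ⟨n, hσxy⟩
  let t : ℕ → X → X → ℝ := fun n x y => (1 / 2 : ℝ) ^ n * min ((r n).1 x y) 1
  have ht0 : ∀ n x y, 0 ≤ t n x y := fun n x y =>
    mul_nonneg (by positivity) (le_min ((r n).2.nonneg x y) zero_le_one)
  have hts : ∀ x y, Summable fun n => t n x y := fun x y =>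
    Summable.of_nonneg_of_le (fun n => ht0 n x y)
      (fun n => mul_le_of_le_one_right (by positivity) (min_le_right _ _)) summable_geometric_two
  have htc : Continuous fun p : X × X => ∑' n, t n p.1 p.2 := by
    refine continuous_tsum (fun n => continuous_const.mul ((r n).2.continuous.min continuous_const))
      summable_geometric_two fun n p => ?_
    rw [Real.norm_of_nonneg (ht0 n _ _)]
    exact mul_le_of_le_one_right (by positivity) (min_le_right _ _)
  have hself : ∀ x, ∑' n, t n x x = 0 := fun x => by
    have : ∀ n, t n x x = 0 := fun n => by simp [t, (r n).2.self]
    simp [this]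
  have hρ : IsInvariantPseudometric G fun x y => ∑' n, t n x y := by
    refine ⟨hself, fun x y => ?_, fun x y z => ?_, fun g x y => ?_, fun x ε hε => ?_⟩
    · simp only [t, (r _).2.symm x y]
    · rw [← (hts x y).tsum_add (hts y z)]
      refine (hts x z).tsum_le_tsum (fun n => ?_) ((hts x y).add (hts y z))
      simp only [t]
      rw [← mul_add]
      refine mul_le_mul_of_nonneg_left ?_ (by positivity)
      have h1 := (r n).2.triangle x y z
      have h2 := (r n).2.nonneg x y
      have h3 := (r n).2.nonneg y z
      rcases min_cases ((r n).1 x y) 1 with h | h <;> rcases min_cases ((r n).1 y z) 1 with h' | h' <;>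
        rcases min_cases ((r n).1 x z) 1 with h'' | h'' <;> linarith
    · simp only [t, (r _).2.smul g]
    · have hc : Continuous fun y => ∑' n, t n x y := htc.comp (Continuous.prodMk_right x)
      exact hc.continuousAt.eventually_lt continuousAt_const (by simpa [hself x] using hε)
  refine ⟨_, hρ, fun x y => ⟨fun h => hρ.eq_zero_of_rel h, fun h => ?_⟩⟩
  by_contra hxy
  obtain ⟨n, hn⟩ := hsep x y hxy
  have h1 : 0 < t n x y := mul_pos (by positivity)
    (lt_min (lt_of_le_of_ne ((r n).2.nonneg x y) hn.symm) zero_lt_one)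
  have h2 := (hts x y).le_tsum n fun m _ => ht0 m x y
  linarith

theorem exists_metricSpace_maxEquicontinuousFactor (G X : Type*) [Group G] [MetricSpace X]
    [CompactSpace X] [MulAction G X] [ContinuousConstSMul G X] :
    ∃ m : MetricSpace (MaxEquicontinuousFactor G X),
      MaxEquicontinuousFactor.instTopologicalSpace G X =
        m.toPseudoMetricSpace.toUniformSpace.toTopologicalSpace ∧
      ∀ (g : G) (a b : MaxEquicontinuousFactor G X), m.dist (g • a) (g • b) = m.dist a b := by
  obtain ⟨ρ, hρ, h⟩ := exists_pseudometric_equicontinuousStructureRel G X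
  obtain ⟨m, hm, hd⟩ := hρ.exists_metricSpace_quotient _ h
  refine ⟨m, hm, ?_⟩
  rintro g ⟨a⟩ ⟨b⟩
  exact (hd _ _).trans ((hρ.smul g a b).trans (hd a b).symm)

/-! ## The maximal equicontinuous factor as a topological dynamical system -/

section MaxEquicontinuousFactor

variable (G : Type*) {X : Type*} [Group G] [TopologicalSpace X] [MulAction G X]

theorem continuous_piEq : Continuous (piEq G : X → MaxEquicontinuousFactor G X) :=
  continuous_quotient_mk'

theorem surjective_piEq : Function.Surjective (piEq G : X → MaxEquicontinuousFactor G X) :=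
  Quotient.mk_surjective

variable {G} in
theorem piEq_smul (g : G) (x : X) : piEq G (g • x) = g • piEq G x := rfl

variable {G} in
theorem piEq_eq_iff {x y : X} : piEq G x = piEq G y ↔ equicontinuousStructureRel G X x y :=
  Quotient.eq

end MaxEquicontinuousFactor

section CompactMaxEquicontinuousFactor

variable (G : Type*) {X : Type*} [Group G] [MetricSpace X] [CompactSpace X]
  [MulAction G X] [ContinuousConstSMul G X]

instance : CompactSpace (MaxEquicontinuousFactor G X) :=
  inferInstanceAs (CompactSpace (Quotient (equicontinuousStructureRel G X)))

instance [Nonempty X] : Nonempty (MaxEquicontinuousFactor G X) :=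
  ‹Nonempty X›.map (piEq G)

instance : TopologicalSpace.MetrizableSpace (MaxEquicontinuousFactor G X) := by
  obtain ⟨m, hm, -⟩ := exists_metricSpace_maxEquicontinuousFactor G X
  let := m.replaceTopology hm
  exact EMetricSpace.metrizableSpace

instance : ContinuousConstSMul G (MaxEquicontinuousFactor G X) := by
  refine ⟨fun g => ?_⟩
  refine isQuotientMap_quotient_mk'.continuous_iff.2 ?_
  exact (continuous_piEq G).comp (continuous_const_smul g)

instance [MulAction.IsMinimal G X] : MulAction.IsMinimal G (MaxEquicontinuousFactor G X) := by
  refine ⟨fun y => ?_⟩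
  obtain ⟨x, rfl⟩ := surjective_piEq G y
  have h := (surjective_piEq G).denseRange.dense_image (continuous_piEq G)
    (MulAction.dense_orbit G x)
  refine h.mono ?_
  rintro _ ⟨_, ⟨g, rfl⟩, rfl⟩
  exact ⟨g, rfl⟩

theorem isClosedMap_piEq : IsClosedMap (piEq G : X → MaxEquicontinuousFactor G X) :=
  (continuous_piEq G).isClosedMap

/-- Finitely many translates of a closed ball inside `V` cover `X`, so Baire applies to their closed
images. -/
theorem exists_nonempty_interior_image_piEq [Nonempty X] [MulAction.IsMinimal G X] {V : Set X}
    (hV : IsOpen V) (hne : V.Nonempty) : (interior (piEq G '' V)).Nonempty := by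
  obtain ⟨x, hx⟩ := hne
  obtain ⟨ε, hε, hC⟩ := Metric.nhds_basis_closedBall.mem_iff.1 (hV.mem_nhds hx)
  obtain ⟨I, hI⟩ := (isCompact_univ (X := X)).exists_finite_cover_smul G
    (Metric.isOpen_ball (x := x) (ε := ε)) ⟨x, Metric.mem_ball_self hε⟩
  let C : Set (MaxEquicontinuousFactor G X) := piEq G '' Metric.closedBall x ε
  have hCc : IsClosed C := isClosedMap_piEq G _ Metric.isClosed_closedBall
  have hcov : ⋃ g : I, (g : G) • C = univ := by
    refine eq_univ_of_forall fun y => ?_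
    obtain ⟨a, rfl⟩ := surjective_piEq G y
    obtain ⟨g, hg, b, hb, rfl⟩ := mem_iUnion₂.1 (hI (mem_univ a))
    exact mem_iUnion.2 ⟨⟨g, hg⟩, piEq G b, ⟨b, Metric.ball_subset_closedBall hb, rfl⟩, rfl⟩
  obtain ⟨g, hg⟩ := nonempty_interior_of_iUnion_of_closed (fun g : I => hCc.smul (g : G)) hcov
  rw [interior_smul, smul_set_nonempty] at hg
  exact hg.mono (interior_mono (image_mono hC))

end CompactMaxEquicontinuousFactor

/-! ## Sections of closed invariant sets -/

section Sections

variable {G X Z : Type*} [Group G] [MetricSpace X] [MulAction G X]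
  [MulAction.IsMinimal G X] [MetricSpace Z] [CompactSpace Z] [MeasurableSpace Z]
  [BorelSpace Z] [MulAction G Z]

/-- Only continuity needs an argument. Sections of a closed set vary upper semicontinuously, which
controls one half of the symmetric difference; all sections have equal measure, so the other half
has the same measure. -/
theorem isInvariantPseudometric_measure_symmDiff [ContinuousConstSMul G Z] (μ : Measure Z)
    [IsProbabilityMeasure μ] [SMulInvariantMeasure G Z μ] {W : Set (X × Z)} (hW : IsClosed W)
    (hinv : ∀ (g : G), ∀ p ∈ W, g • p ∈ W) :
    IsInvariantPseudometric G fun x y : X =>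
      μ.real ((Prod.mk x ⁻¹' W) ∆ (Prod.mk y ⁻¹' W)) := by
  have hcl : ∀ x, IsClosed (Prod.mk x ⁻¹' W) := fun x => hW.preimage (Continuous.prodMk_right x)
  have hms : ∀ x, MeasurableSet (Prod.mk x ⁻¹' W) := fun x => (hcl x).measurableSet
  have hsm : ∀ (g : G) x, Prod.mk (g • x) ⁻¹' W = g • (Prod.mk x ⁻¹' W) := by
    intro g x
    ext z
    rw [mem_smul_set_iff_inv_smul_mem]
    constructor
    · intro h
      simpa using hinv g⁻¹ _ h
    · intro h
      simpa using hinv g _ h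
  have husc : ∀ x, ∀ ε > 0, ∀ᶠ y in 𝓝 x, μ.real ((Prod.mk y ⁻¹' W) \ (Prod.mk x ⁻¹' W)) < ε := by
    intro x ε hε
    obtain ⟨O, hO, hOo, hOμ⟩ := (Prod.mk x ⁻¹' W).exists_isOpen_lt_add (μ := μ)
      (measure_ne_top _ _) (ENNReal.ofReal_pos.2 hε).ne'
    have h1 : ∀ᶠ y in 𝓝 x, ∀ z ∈ Oᶜ, (y, z) ∉ W := by
      refine hOo.isClosed_compl.isCompact.eventually_forall_of_forall_eventually fun z hz => ?_
      have : Wᶜ ∈ 𝓝 (x, z) := hW.isOpen_compl.mem_nhds fun h => hz (hO h)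
      exact this
    filter_upwards [h1] with y hy
    have h2 : (Prod.mk y ⁻¹' W) \ (Prod.mk x ⁻¹' W) ⊆ O \ (Prod.mk x ⁻¹' W) :=
      sdiff_subset_sdiff_left fun z hz => by_contra fun h => hy z h hz
    refine (measureReal_mono h2).trans_lt ?_
    rw [measureReal_def, measure_sdiff hO (hms x).nullMeasurableSet (measure_ne_top _ _)]
    exact (ENNReal.lt_ofReal_iff_toReal_lt
      (ENNReal.sub_ne_top (measure_ne_top _ _))).1 (by
        rw [ENNReal.sub_lt_iff_lt_left (measure_ne_top _ _) (measure_mono hO)]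
        exact hOμ)
  -- The measure of a section is constant along orbits, and minimality moves `x` close to `y`, where
  -- semicontinuity compares the two sections.
  have hconst : ∀ x y, μ.real (Prod.mk x ⁻¹' W) ≤ μ.real (Prod.mk y ⁻¹' W) := by
    intro x y
    refine le_of_forall_pos_le_add fun ε hε => ?_
    obtain ⟨N, hN, hNo, hyN⟩ := eventually_nhds_iff.1 (husc y ε hε)
    obtain ⟨g, hg⟩ := hNo.exists_smul_mem G x ⟨y, hyN⟩
    have h1 := hN _ hg
    have h2 : μ.real (Prod.mk (g • x) ⁻¹' W) = μ.real (Prod.mk x ⁻¹' W) := by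
      rw [hsm, measureReal_def, measure_smul, measureReal_def]
    have h3 := measureReal_sdiff_add_inter (μ := μ) (s := Prod.mk (g • x) ⁻¹' W) (hms y)
    have h4 : μ.real (Prod.mk (g • x) ⁻¹' W ∩ Prod.mk y ⁻¹' W) ≤ μ.real (Prod.mk y ⁻¹' W) :=
      measureReal_mono inter_subset_right
    linarith
  refine ⟨fun x => by simp, fun x y => by rw [symmDiff_comm], fun x y z => ?_, fun g x y => ?_,
    fun x ε hε => ?_⟩
  · exact (measureReal_mono (symmDiff_triangle _ (Prod.mk y ⁻¹' W) _)).trans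
      (measureReal_union_le _ _)
  · rw [hsm, hsm, ← smul_set_symmDiff, measureReal_def, measure_smul, measureReal_def]
  · filter_upwards [husc x (ε / 2) (half_pos hε)] with y hy
    have h1 := measureReal_sdiff_add_inter (μ := μ) (s := Prod.mk x ⁻¹' W) (hms y)
    have h2 := measureReal_sdiff_add_inter (μ := μ) (s := Prod.mk y ⁻¹' W) (hms x)
    rw [inter_comm] at h2
    have h3 := (hconst x y).antisymm (hconst y x)
    have h4 : μ.real ((Prod.mk x ⁻¹' W) ∆ (Prod.mk y ⁻¹' W)) ≤
        μ.real (Prod.mk x ⁻¹' W \ Prod.mk y ⁻¹' W) + μ.real (Prod.mk y ⁻¹' W \ Prod.mk x ⁻¹' W) :=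
      measureReal_union_le _ _
    linarith

theorem subset_section_of_rel [CompactSpace X] [ContinuousConstSMul G Z] (μ : Measure Z)
    [IsProbabilityMeasure μ] [SMulInvariantMeasure G Z μ] [μ.IsOpenPosMeasure] {W : Set (X × Z)}
    (hW : IsClosed W) (hinv : ∀ (g : G), ∀ p ∈ W, g • p ∈ W) {x y : X}
    (hxy : equicontinuousStructureRel G X x y) {O : Set Z} (hO : IsOpen O)
    (hOx : ∀ z ∈ O, (x, z) ∈ W) : ∀ z ∈ O, (y, z) ∈ W := by
  have h0 := (isInvariantPseudometric_measure_symmDiff μ hW hinv).eq_zero_of_rel hxy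
  have hopen : IsOpen (O \ (Prod.mk y ⁻¹' W)) :=
    hO.sdiff (hW.preimage (Continuous.prodMk_right y))
  have hsub : O \ (Prod.mk y ⁻¹' W) ⊆ (Prod.mk x ⁻¹' W) ∆ (Prod.mk y ⁻¹' W) :=
    fun z hz => Or.inl ⟨hOx z hz.1, hz.2⟩
  have h1 : μ (O \ (Prod.mk y ⁻¹' W)) = 0 :=
    measure_mono_null hsub ((measureReal_eq_zero_iff (measure_ne_top _ _)).1 h0)
  have h2 := (hopen.measure_eq_zero_iff μ).1 h1
  exact fun z hz => by_contra fun h => (h2 ▸ (⟨hz, h⟩ : z ∈ O \ (Prod.mk y ⁻¹' W)) : z ∈ (∅ : Set Z))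

end Sections

/-! ## Tuples in a fiber are regionally proximal -/

section Tuples

theorem smulInvariantMeasure_pi {G X ι : Type*} [Fintype ι] [Group G] [MulAction G X]
    [MeasurableSpace X] [MeasurableConstSMul G X] (μ : Measure X) [IsProbabilityMeasure μ]
    [SMulInvariantMeasure G X μ] :
    SMulInvariantMeasure G (ι → X) (Measure.pi fun _ => μ) := by
  refine ⟨fun g s hs => ?_⟩
  have h := measurePreserving_pi (fun _ : ι => μ) (fun _ => μ) fun _ => measurePreserving_smul g μ
  exact h.measure_preimage hs.nullMeasurableSet

variable {G X : Type*} [Group G] [MetricSpace X] [CompactSpace X] [Nonempty X]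
  [MulAction G X] [ContinuousConstSMul G X] [MulAction.IsMinimal G X]

theorem mem_of_isClosed_of_fiber (hG : IsAmenableGroup G) {ι : Type*} [Fintype ι]
    {V : Set X} (hV : IsOpen V) (hne : V.Nonempty) {W : Set (ι → X)} (hW : IsClosed W)
    (hinv : ∀ (g : G), ∀ u ∈ W, g • u ∈ W) (hVW : ∀ u : ι → X, (∀ i, u i ∈ V) → u ∈ W)
    {y : MaxEquicontinuousFactor G X} {z : ι → X} (hz : ∀ i, piEq G (z i) = y) : z ∈ W := by
  classical
  borelize X
  obtain ⟨μ, hμ, hμG⟩ := exists_invariant_probability (X := X) hG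
  have : μ.IsOpenPosMeasure := ⟨fun U hU hUne =>
    (measure_isOpen_pos_of_smulInvariant_of_compact_ne_zero G isCompact_univ
      (by simp) hU hUne).ne'⟩
  have := smulInvariantMeasure_pi (G := G) (ι := ι) μ
  let O := interior (piEq G '' V)
  let P : Set X := piEq G ⁻¹' O
  have hP : IsOpen P := isOpen_interior.preimage (continuous_piEq G)
  have key : ∀ s : Finset ι, ∀ u : ι → X, (∀ i, u i ∈ if i ∈ s then P else V) → u ∈ W := by
    intro s
    induction s using Finset.induction_on with
    | empty => simpa using hVW
    | insert i s his ih =>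
      intro u hu
      have hui : u i ∈ P := by simpa using hu i
      obtain ⟨a, haV, ha⟩ := interior_subset hui
      -- Coordinate `i` is split off as the base point, the whole power serving as `Z`; coordinate
      -- `i` of the second factor is a dummy, which is why `Q` leaves it free.
      let W' : Set (X × (ι → X)) := {p | Function.update p.2 i p.1 ∈ W}
      have hW' : IsClosed W' := hW.preimage (continuous_snd.update i continuous_fst)
      have hinv' : ∀ (g : G), ∀ p ∈ W', g • p ∈ W' := by
        intro g p hp
        have h1 : Function.update (g • p).2 i (g • p).1 = g • Function.update p.2 i p.1 := by
          ext j
          rcases eq_or_ne j i with rfl | hj <;> simp [*]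
        change Function.update (g • p).2 i (g • p).1 ∈ W
        rw [h1]
        exact hinv g _ hp
      let Q : Set (ι → X) := univ.pi fun j => if j = i then univ else if j ∈ s then P else V
      have hQ : IsOpen Q := isOpen_set_pi finite_univ fun j _ => by
        split_ifs
        exacts [isOpen_univ, hP, hV]
      have hQa : ∀ v ∈ Q, (a, v) ∈ W' := by
        intro v hv
        refine ih _ fun j => ?_
        rcases eq_or_ne j i with rfl | hj
        · simpa [his] using haV
        · have := hv j (mem_univ j)
          simpa [hj] using this
      have hQu : u ∈ Q := by
        intro j _
        rcases eq_or_ne j i with rfl | hj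
        · simp
        · have := hu j
          simpa [hj] using this
      have h2 := subset_section_of_rel (G := G) (Measure.pi fun _ : ι => μ) hW' hinv'
        (piEq_eq_iff.1 ha) hQ hQa u hQu
      simpa [W'] using h2
  obtain ⟨g, hg⟩ := isOpen_interior.exists_smul_mem G y (exists_nonempty_interior_image_piEq G hV hne)
  have h1 : g • z ∈ W := key Finset.univ (g • z) fun i => by
    simp only [Finset.mem_univ, if_true]
    change piEq G (g • z i) ∈ O
    rw [piEq_smul, hz]
    exact hg
  simpa using hinv g⁻¹ _ h1

theorem exists_smul_mem_of_fiber (hG : IsAmenableGroup G) {ι : Type*} [Fintype ι]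
    {U : Set X} (hU : IsOpen U) (hne : U.Nonempty) {y : MaxEquicontinuousFactor G X} {z : ι → X}
    (hz : ∀ i, piEq G (z i) = y) {V : ι → Set X} (hV : ∀ i, IsOpen (V i)) (hzV : ∀ i, z i ∈ V i) :
    ∃ g : G, ∀ i, ((g • U) ∩ V i).Nonempty := by
  -- The closure of this set is closed, invariant and contains all tuples from `U`.
  let S : Set (ι → X) := {u | ∃ g : G, ∀ i, u i ∈ g • U}
  have hS : ∀ (g : G), ∀ u ∈ S, g • u ∈ S := by
    rintro g u ⟨h, hu⟩
    refine ⟨g * h, fun i => ?_⟩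
    rw [mul_smul]
    exact smul_mem_smul_set (hu i)
  have h1 : z ∈ closure S := by
    refine mem_of_isClosed_of_fiber hG hU hne isClosed_closure ?_ ?_ hz
    · intro g u hu
      exact map_mem_closure (continuous_const_smul g) hu (hS g)
    · intro u hu
      exact subset_closure ⟨1, fun i => by simpa using hu i⟩
  obtain ⟨u, huV, g, hg⟩ := mem_closure_iff.1 h1 (univ.pi V)
    (isOpen_set_pi finite_univ fun i _ => hV i) fun i _ => hzV i
  exact ⟨g, fun i => ⟨u i, hg i, huV i (mem_univ i)⟩⟩

end Tuples

/-! ## Unique ergodicity of the maximal equicontinuous factor -/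

theorem exists_isUniqueInvariantProbability {G : Type*} (X : Type*) [Group G] [MetricSpace X]
    [CompactSpace X] [Nonempty X] [MulAction G X] [ContinuousConstSMul G X]
    [MulAction.IsMinimal G X] (hG : IsAmenableGroup G) :
    ∃ ν : Measure (MaxEquicontinuousFactor G X), IsUniqueInvariantProbability G ν := by
  obtain ⟨m, hm, hd⟩ := exists_metricSpace_maxEquicontinuousFactor G X
  let := m.replaceTopology hm
  obtain ⟨ν, h1, h2⟩ := exists_invariant_probability (X := MaxEquicontinuousFactor G X) hG
  exact ⟨ν, ⟨h1, h2⟩, fun ν' _ _ => invariant_probability_unique hG hd ν' ν⟩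

/-- Conditioning on an invariant set of positive measure gives another invariant probability
measure, which must be `ν`. -/
theorem IsUniqueInvariantProbability.measure_eq_zero_or_one {G Y : Type*} [Group G]
    [MeasurableSpace Y] [MulAction G Y] [MeasurableConstSMul G Y] {ν : Measure Y}
    (hν : IsUniqueInvariantProbability G ν) {A : Set Y} (hA : MeasurableSet A)
    (hinv : ∀ g : G, (g • ·) ⁻¹' A = A) : ν A = 0 ∨ ν A = 1 := by
  obtain ⟨⟨hp, hi⟩, hu⟩ := hν
  by_cases h0 : ν A = 0
  · exact Or.inl h0
  right
  have h1 := ProbabilityTheory.cond_isProbabilityMeasure h0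
  have h2 : SMulInvariantMeasure G Y (ProbabilityTheory.cond ν A) := by
    refine ⟨fun g s hs => ?_⟩
    rw [ProbabilityTheory.cond_apply hA, ProbabilityTheory.cond_apply hA]
    congr 1
    conv_lhs => rw [← hinv g, ← preimage_inter]
    exact hi.1 g (hA.inter hs)
  have h3 := hu _ h1 h2
  rw [← h3, ProbabilityTheory.cond_apply_self (h0) (measure_ne_top _ _)]

/-! ## A sufficient condition for weak mean-sensitivity -/

theorem le_upperBanachDensity {G : Type*} [Group G] {F : ℕ → Finset G} (hF : IsFolnerSeq F)
    {S : Set G} {c : ℝ≥0∞}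
    (h : ∀ n, ∃ k : G, ∃ E ⊆ F n, c * (F n).card ≤ E.card ∧ ∀ g ∈ E, g * k ∈ S) :
    c ≤ upperBanachDensity S := by
  classical
  choose k E hEF hcE hES using h
  refine le_iSup₂_of_le _ (hF.mul_right k) ?_
  refine le_trans ?_ (liminf_le_limsup)
  refine le_liminf_of_le (by isBoundedDefault) (Eventually.of_forall fun n => ?_)
  have hinj : Function.Injective (· * k n) := mul_left_injective (k n)
  have hne : ((F n).card : ℝ≥0∞) ≠ 0 := by simpa using (hF.1 n).ne_empty
  rw [Finset.card_image_of_injective _ hinj,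
    ENNReal.le_div_iff_mul_le (Or.inl hne) (Or.inl (ENNReal.natCast_ne_top _))]
  refine (hcE n).trans ?_
  rw [← Finset.card_image_of_injective (E n) hinj, ← ncard_coe_finset]
  refine Nat.cast_le.2 (ncard_le_ncard ?_ ((Finset.finite_toSet _).inter_of_left _))
  intro x hx
  obtain ⟨g, hg, rfl⟩ := Finset.mem_image.1 hx
  exact ⟨Finset.mem_image_of_mem _ (hEF n hg), hES n g hg⟩

/-- The number of visits to `A` along `F` has integral `ν A * F.card`, and some point attains at
least the mean. -/
theorem exists_measure_mul_card_le {G Y : Type*} [Group G] [MeasurableSpace Y] [MulAction G Y]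
    [MeasurableConstSMul G Y] (ν : Measure Y) [IsProbabilityMeasure ν] [SMulInvariantMeasure G Y ν]
    {A : Set Y} (hA : MeasurableSet A) (F : Finset G) :
    ∃ y, ∃ E ⊆ F, ν A * F.card ≤ E.card ∧ ∀ g ∈ E, g • y ∈ A := by
  classical
  have hlint : ∫⁻ y, ∑ g ∈ F, A.indicator 1 (g • y) ∂ν = ν A * F.card := by
    rw [lintegral_finsetSum]
    · have : ∀ g ∈ F, ∫⁻ y, A.indicator 1 (g • y) ∂ν = ν A := fun g _ => by
        rw [(measurePreserving_smul g ν).lintegral_comp (measurable_one.indicator hA),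
          lintegral_indicator_one hA]
      rw [Finset.sum_congr rfl this, Finset.sum_const, nsmul_eq_mul, mul_comm]
    · intro g _
      exact (measurable_one.indicator hA).comp (measurable_const_smul g)
  obtain ⟨y, hy⟩ := exists_lintegral_le (μ := ν)
    (f := fun y => ∑ g ∈ F, A.indicator (1 : Y → ℝ≥0∞) (g • y)) (by
      rw [hlint]
      exact ENNReal.mul_ne_top (measure_ne_top _ _) (ENNReal.natCast_ne_top _))
  refine ⟨y, F.filter fun g => g • y ∈ A, Finset.filter_subset _ _, ?_, fun g hg =>
    (Finset.mem_filter.1 hg).2⟩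
  rw [hlint] at hy
  refine hy.trans (le_of_eq ?_)
  rw [Finset.card_filter]
  push_cast
  exact Finset.sum_congr rfl fun g _ => by simp [indicator_apply]

section Criterion

variable {G X : Type*} [Group G] [MetricSpace X] [CompactSpace X] [Nonempty X]
  [MulAction G X] [ContinuousConstSMul G X] [MulAction.IsMinimal G X]

theorem isWeaklyMeanSensitiveTuple_of_measure_ne_zero (hG : IsAmenableGroup G)
    (ν : Measure (MaxEquicontinuousFactor G X)) [IsProbabilityMeasure ν]
    [SMulInvariantMeasure G (MaxEquicontinuousFactor G X) ν] {K : ℕ} {x : Fin K → X}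
    (h : ∀ V : Fin K → Set X, (∀ k, IsOpen (V k) ∧ x k ∈ V k) → ν (⋂ k, piEq G '' V k) ≠ 0) :
    IsWeaklyMeanSensitiveTuple G x := by
  intro V hV
  have hr : ∀ k, ∃ r > 0, Metric.closedBall (x k) r ⊆ V k := fun k =>
    Metric.nhds_basis_closedBall.mem_iff.1 ((hV k).1.mem_nhds (hV k).2)
  choose r hr hrV using hr
  -- Closed balls have closed, hence Borel, images.
  let A : Set (MaxEquicontinuousFactor G X) := ⋂ k, piEq G '' Metric.closedBall (x k) (r k)
  have hA : MeasurableSet A := MeasurableSet.iInter fun k =>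
    (isClosedMap_piEq G _ Metric.isClosed_closedBall).measurableSet
  have hνA : ν A ≠ 0 := by
    have h1 := h (fun k => Metric.ball (x k) (r k)) fun k =>
      ⟨Metric.isOpen_ball, Metric.mem_ball_self (hr k)⟩
    refine fun h0 => h1 (measure_mono_null ?_ h0)
    exact iInter_mono fun k => image_mono Metric.ball_subset_closedBall
  refine ⟨ν A / 2, ENNReal.half_pos hνA, fun U hU hne => ?_⟩
  refine (ENNReal.half_lt_self hνA (measure_ne_top _ _)).trans_le ?_
  obtain ⟨F, hF⟩ := id hG
  refine le_upperBanachDensity hF fun n => ?_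
  obtain ⟨y, E, hEF, hcard, hE⟩ := exists_measure_mul_card_le ν hA (F n)
  have hz : ∀ (g : E) (k : Fin K), ∃ z : X, piEq G z = y ∧ (g : G) • z ∈ V k := by
    rintro ⟨g, hg⟩ k
    obtain ⟨v, hv, hvy⟩ := mem_iInter.1 (hE g hg) k
    refine ⟨g⁻¹ • v, ?_, ?_⟩
    · rw [piEq_smul, hvy, inv_smul_smul]
    · simpa using hrV k hv
  choose z hzy hzV using hz
  -- The tuple is indexed by `E × Fin K`, so one `k` serves all `g ∈ E` and all coordinates at once.
  obtain ⟨k, hk⟩ := exists_smul_mem_of_fiber hG hU hne (ι := E × Fin K) (y := y)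
    (z := fun p => z p.1 p.2) (fun p => hzy _ _) (V := fun p => (p.1 : G)⁻¹ • V p.2)
    (fun p => (hV p.2).1.smul _) fun p => by
      rw [mem_inv_smul_set_iff]
      exact hzV _ _
  refine ⟨k, E, hEF, hcard, fun g hg j => ?_⟩
  obtain ⟨u, hu, hu'⟩ := hk (⟨g, hg⟩, j)
  refine ⟨g • u, ?_, mem_inv_smul_set_iff.1 hu'⟩
  rw [mul_smul]
  exact smul_mem_smul_set hu

/-- Otherwise each tuple of `T` has a product neighborhood whose images meet in a null set; finitely
many of these cover `T`, and `D` would be null. -/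
theorem exists_isWeaklyMeanSensitiveTuple_of_isCompact (hG : IsAmenableGroup G)
    (ν : Measure (MaxEquicontinuousFactor G X)) [IsProbabilityMeasure ν]
    [SMulInvariantMeasure G (MaxEquicontinuousFactor G X) ν] {K : ℕ} {T : Set (Fin K → X)}
    (hT : IsCompact T) {D : Set (MaxEquicontinuousFactor G X)} (hD : ν D ≠ 0)
    (hDT : ∀ y ∈ D, ∃ z ∈ T, ∀ k, piEq G (z k) = y) :
    ∃ z ∈ T, IsWeaklyMeanSensitiveTuple G z := by
  by_contra! hcon
  have hbad : ∀ z ∈ T, ∃ V : Fin K → Set X, (∀ k, IsOpen (V k) ∧ z k ∈ V k) ∧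
      ν (⋂ k, piEq G '' V k) = 0 := by
    intro z hz
    by_contra! h
    exact hcon z hz (isWeaklyMeanSensitiveTuple_of_measure_ne_zero hG ν h)
  choose! V hV hV0 using hbad
  obtain ⟨t, htT, ht⟩ := hT.elim_nhds_subcover (fun z => univ.pi (V z)) fun z hz =>
    set_pi_mem_nhds finite_univ fun k _ => (hV z hz k).1.mem_nhds (hV z hz k).2
  refine hD (measure_mono_null ?_ ((measure_biUnion_null_iff t.countable_toSet).2
    fun z hz => hV0 z (htT z hz)))
  intro y hy
  obtain ⟨z, hz, hzy⟩ := hDT y hy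
  obtain ⟨w, hw, hzw⟩ := mem_iUnion₂.1 (ht hz)
  exact mem_iUnion₂.2 ⟨w, hw, mem_iInter.2 fun k => ⟨z k, hzw k (mem_univ k), hzy k⟩⟩

theorem isClosed_setOf_isWeaklyMeanSensitiveTuple (G X : Type*) [Group G] [TopologicalSpace X]
    [MulAction G X] (K : ℕ) : IsClosed {z : Fin K → X | IsWeaklyMeanSensitiveTuple G z} := by
  refine isClosed_of_closure_subset fun z hz V hV => ?_
  obtain ⟨w, hw, hw'⟩ := mem_closure_iff.1 hz (univ.pi V)
    (isOpen_set_pi finite_univ fun k _ => (hV k).1) fun k _ => (hV k).2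
  exact hw' V fun k => ⟨(hV k).1, hw k (mem_univ k)⟩

end Criterion

/-! ## Mutual singularity of ergodic measures -/

theorem ErgodicSMul.exists_rnDeriv_eq_const {G X : Type*} [Group G] [MeasurableSpace X]
    [MulAction G X] [MeasurableConstSMul G X] (μ ν : Measure X) [IsFiniteMeasure μ]
    [IsFiniteMeasure ν] [SMulInvariantMeasure G X μ] [ErgodicSMul G X ν] :
    ∃ c : ℝ≥0∞, μ.rnDeriv ν =ᵐ[ν] fun _ => c := by
  refine exists_eventuallyEq_const_of_forall_separating MeasurableSet fun U hU => ?_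
  refine eventuallyConst_set.1 (ErgodicSMul.aeconst_of_forall_preimage_smul_ae_eq (G := G)
    (s := μ.rnDeriv ν ⁻¹' U) (Measure.measurable_rnDeriv μ ν hU) fun g => ?_)
  have h := (measurePreserving_smul g μ).rnDeriv_comp_aeEq (measurePreserving_smul g ν)
  exact h.preimage U

/-- The Radon-Nikodym derivative is invariant, hence almost everywhere constant: zero means
singular, and otherwise the measures are proportional. -/
theorem ErgodicSMul.eq_or_mutuallySingular (G : Type*) {X : Type*} [Group G] [MeasurableSpace X]
    [MulAction G X] [MeasurableConstSMul G X] (μ ν : Measure X) [IsProbabilityMeasure μ]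
    [IsProbabilityMeasure ν] [ErgodicSMul G X μ] [ErgodicSMul G X ν] : μ = ν ∨ μ ⟂ₘ ν := by
  obtain ⟨c, hc⟩ := ErgodicSMul.exists_rnDeriv_eq_const (G := G) μ ν
  by_cases h0 : c = 0
  · right
    rw [← Measure.rnDeriv_eq_zero]
    subst h0
    exact hc
  left
  have hle : c • ν ≤ μ := by
    rw [← withDensity_const, ← withDensity_congr_ae hc]
    exact Measure.withDensity_rnDeriv_le μ ν
  have hac : ν ≪ μ :=
    (Measure.absolutelyContinuous_smul h0).trans (Measure.absolutelyContinuous_of_le hle)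
  obtain ⟨d, hd⟩ := ErgodicSMul.exists_rnDeriv_eq_const (G := G) ν μ
  have h1 : ν = d • μ := by
    rw [← withDensity_const, ← withDensity_congr_ae hd, Measure.withDensity_rnDeriv_eq ν μ hac]
  have h2 : d = 1 := by
    have := congrArg (fun m : Measure X => m univ) h1
    simpa using this.symm
  rw [h1, h2, one_smul]

theorem exists_pairwise_disjoint_of_mutuallySingular {ι X : Type*} [Finite ι] [MeasurableSpace X]
    (μ : ι → Measure X) (h : Pairwise fun i j => μ i ⟂ₘ μ j) :
    ∃ A : ι → Set X, (∀ i, MeasurableSet (A i)) ∧ (∀ i, μ i (A i)ᶜ = 0) ∧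
      Pairwise fun i j => Disjoint (A i) (A j) := by
  have hs : ∀ i j, ∃ s, i ≠ j → MeasurableSet s ∧ μ i s = 0 ∧ μ j sᶜ = 0 := fun i j => by
    by_cases hij : i = j
    · exact ⟨∅, fun hne => absurd hij hne⟩
    · obtain ⟨s, hs⟩ := h hij
      exact ⟨s, fun _ => hs⟩
  choose s hs using hs
  -- The sets `s i j` and `s j i` are chosen independently; using both makes `A i` avoid `s i j`
  -- while `A j` lies inside it.
  refine ⟨fun i => ⋂ j, ⋂ _ : i ≠ j, (s i j)ᶜ ∩ s j i, fun i => ?_, fun i => ?_, fun i j hij => ?_⟩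
  · exact MeasurableSet.iInter fun j => MeasurableSet.iInter fun hij =>
      (hs i j hij).1.compl.inter (hs j i hij.symm).1
  · simp only [compl_iInter, measure_iUnion_null_iff]
    intro j hij
    rw [compl_inter, compl_compl]
    exact measure_union_null (hs i j hij).2.1 (hs j i hij.symm).2.2
  · refine Set.disjoint_left.2 fun x hx hx' => ?_
    exact (mem_iInter₂.1 hx j hij).1 (mem_iInter₂.1 hx' i hij.symm).2

/-! ## Fibers with many points -/

section Fibers

variable {G X : Type*} [Group G] [MetricSpace X] [CompactSpace X]
  [MulAction G X] [ContinuousConstSMul G X]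

theorem exists_injective_of_le_encard {α : Type*} {s : Set α} {K : ℕ} (h : (K : ℕ∞) ≤ s.encard) :
    ∃ z : Fin K → α, Function.Injective z ∧ ∀ k, z k ∈ s := by
  obtain ⟨t, hts, ht⟩ := exists_subset_encard_eq h
  have htf : t.Finite := finite_of_encard_eq_coe ht
  have := htf.fintype
  have hc : Fintype.card t = K := by
    rw [← Nat.cast_inj (R := ℕ∞), ← ht, encard_eq_coe_toFinset_card, toFinset_card]
  let e := (Fintype.equivFinOfCardEq hc).symm
  exact ⟨fun k => e k, Subtype.val_injective.comp e.injective, fun k => hts (e k).2⟩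

variable (G X) in
/-- The points of the maximal equicontinuous factor whose fiber contains `K` points with mutual
distances at least `r`. -/
def separatedFiberSet (K : ℕ) (r : ℝ) : Set (MaxEquicontinuousFactor G X) :=
  {y | ∃ z : Fin K → X, (∀ k, piEq G (z k) = y) ∧ ∀ i j, i ≠ j → r ≤ dist (z i) (z j)}

theorem isClosed_setOf_exists_fiber {K : ℕ} {S : Set (Fin K → X)} (hS : IsClosed S) :
    IsClosed {y : MaxEquicontinuousFactor G X | ∃ z ∈ S, ∀ k, piEq G (z k) = y} := by
  have h1 : IsClosed {p : MaxEquicontinuousFactor G X × (Fin K → X) |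
      p.2 ∈ S ∧ ∀ k, piEq G (p.2 k) = p.1} := by
    refine (hS.preimage continuous_snd).inter ?_
    change IsClosed {p : MaxEquicontinuousFactor G X × (Fin K → X) | ∀ k, piEq G (p.2 k) = p.1}
    simp only [ofPred_forall]
    exact isClosed_iInter fun k => isClosed_eq
      ((continuous_piEq G).comp ((continuous_apply k).comp continuous_snd)) continuous_fst
  have h2 := (h1.isCompact.image continuous_fst).isClosed
  convert h2 using 1
  ext y
  constructor
  · rintro ⟨z, hz, hzy⟩
    exact ⟨(y, z), ⟨hz, hzy⟩, rfl⟩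
  · rintro ⟨⟨y, z⟩, ⟨hz, hzy⟩, rfl⟩
    exact ⟨z, hz, hzy⟩

omit [CompactSpace X] in
-- The element `g` matters for part 3, where separation is known only after translating the fiber;
-- elsewhere `g = 1`.
theorem isClosed_setOf_le_dist_smul (K : ℕ) (r : ℝ) (g : G) :
    IsClosed {z : Fin K → X | ∀ i j, i ≠ j → r ≤ dist (g • z i) (g • z j)} := by
  simp only [ofPred_forall]
  refine isClosed_iInter fun i => isClosed_iInter fun j => isClosed_iInter fun _ => ?_
  exact isClosed_le continuous_const
    (((continuous_const_smul g).comp (continuous_apply i)).dist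
      ((continuous_const_smul g).comp (continuous_apply j)))

omit [CompactSpace X] [ContinuousConstSMul G X] in
theorem injective_of_le_dist_smul {K : ℕ} {r : ℝ} (hr : 0 < r) {g : G} {z : Fin K → X}
    (h : ∀ i j, i ≠ j → r ≤ dist (g • z i) (g • z j)) : Function.Injective z := by
  intro i j hij
  by_contra hne
  have := h i j hne
  rw [hij, dist_self] at this
  linarith

theorem isClosed_separatedFiberSet (K : ℕ) (r : ℝ) : IsClosed (separatedFiberSet G X K r) := by
  have h := isClosed_setOf_exists_fiber (G := G) (isClosed_setOf_le_dist_smul (X := X) K r (1 : G))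
  simp only [one_smul] at h
  convert h using 1
  ext y
  exact exists_congr fun z => and_comm

omit [CompactSpace X] [ContinuousConstSMul G X] in
-- Exhibits the set as a countable union of closed sets, for measurability in part 1 and Baire
-- category in part 3.
theorem iUnion_separatedFiberSet (K : ℕ) :
    {y : MaxEquicontinuousFactor G X | (K : ℕ∞) ≤ (piEq G ⁻¹' {y} : Set X).encard} =
      ⋃ n : ℕ, separatedFiberSet G X K (1 / ((n : ℝ) + 1)) := by
  ext y
  rw [mem_iUnion]
  constructor
  · intro hy
    obtain ⟨z, hz, hzy⟩ := exists_injective_of_le_encard hy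
    have h1 : ∀ᶠ n : ℕ in atTop, ∀ i j, i ≠ j → 1 / ((n : ℝ) + 1) ≤ dist (z i) (z j) := by
      simp only [eventually_all]
      intro i j hij
      exact tendsto_one_div_add_atTop_nhds_zero_nat.eventually_le_const
        (dist_pos.2 (hz.ne hij))
    obtain ⟨n, hn⟩ := h1.exists
    exact ⟨n, z, hzy, hn⟩
  · rintro ⟨n, z, hzy, hz⟩
    have hinj : Function.Injective z := injective_of_le_dist_smul (G := G) (g := 1)
      (r := 1 / ((n : ℝ) + 1)) (by positivity) (by simpa using hz)
    have h1 : (range z).encard = K := by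
      rw [← image_univ, hinj.encard_image, encard_univ]
      simp
    change (K : ℕ∞) ≤ _
    rw [← h1]
    exact encard_le_encard (range_subset_iff.2 hzy)

omit [CompactSpace X] [ContinuousConstSMul G X] in
theorem encard_fiber_smul (g : G) (y : MaxEquicontinuousFactor G X) :
    (piEq G ⁻¹' {g • y} : Set X).encard = (piEq G ⁻¹' {y} : Set X).encard := by
  rw [← (MulAction.injective g).encard_image (piEq G ⁻¹' {y} : Set X)]
  congr 1
  ext x
  constructor
  · intro hx
    refine ⟨g⁻¹ • x, ?_, smul_inv_smul g x⟩
    change piEq G (g⁻¹ • x) = y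
    rw [piEq_smul, show piEq G x = g • y from hx, inv_smul_smul]
  · rintro ⟨x, hx, rfl⟩
    exact congrArg (g • ·) hx

end Fibers

/-! ## The four parts of the theorem -/

section Main

variable {G X : Type*} [Group G] [MetricSpace X] [CompactSpace X] [Nonempty X]
  [MulAction G X] [ContinuousConstSMul G X] [MulAction.IsMinimal G X]

omit [Nonempty X] in
theorem measure_maxEquicontinuousFactor_ne_zero (ν : Measure (MaxEquicontinuousFactor G X))
    [IsProbabilityMeasure ν] [SMulInvariantMeasure G (MaxEquicontinuousFactor G X) ν]
    {U : Set (MaxEquicontinuousFactor G X)} (hU : IsOpen U) (hne : U.Nonempty) : ν U ≠ 0 :=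
  (measure_isOpen_pos_of_smulInvariant_of_compact_ne_zero G isCompact_univ (by simp) hU hne).ne'

theorem measure_setOf_le_encard_fiber_eq_zero (hG : IsAmenableGroup G)
    (ν : Measure (MaxEquicontinuousFactor G X)) [IsProbabilityMeasure ν]
    [SMulInvariantMeasure G (MaxEquicontinuousFactor G X) ν] {K : ℕ}
    (h : ¬ ∃ x : Fin K → X, IsEssentialWeaklyMeanSensitiveTuple G x) :
    ν {y | (K : ℕ∞) ≤ (piEq G ⁻¹' {y} : Set X).encard} = 0 := by
  rw [iUnion_separatedFiberSet, measure_iUnion_null_iff]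
  intro n
  by_contra hpos
  obtain ⟨z, hz, hzw⟩ := exists_isWeaklyMeanSensitiveTuple_of_isCompact hG ν
    (isClosed_setOf_le_dist_smul (X := X) K (1 / ((n : ℝ) + 1)) (1 : G)).isCompact hpos
    fun y hy => by
      obtain ⟨z, hzy, hz⟩ := hy
      exact ⟨z, by simpa using hz, hzy⟩
  exact h ⟨z, hzw, injective_of_le_dist_smul (by positivity) hz⟩

theorem exists_piEqRegularToOne (hG : IsAmenableGroup G) {K : ℕ}
    (h : ¬ ∃ x : Fin K → X, IsEssentialWeaklyMeanSensitiveTuple G x) :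
    ∃ K' : ℕ, 1 ≤ K' ∧ K' ≤ K - 1 ∧ PiEqRegularToOne G X (K' : ℕ∞) := by
  obtain ⟨ν, hν⟩ := exists_isUniqueInvariantProbability X hG
  have := hν.1.1
  have := hν.1.2
  let E : ℕ → Set (MaxEquicontinuousFactor G X) := fun j =>
    {y | (j : ℕ∞) ≤ (piEq G ⁻¹' {y} : Set X).encard}
  have hEm : ∀ j, MeasurableSet (E j) := fun j => by
    simp only [E]
    rw [iUnion_separatedFiberSet]
    exact MeasurableSet.iUnion fun n => (isClosed_separatedFiberSet _ _).measurableSet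
  have hE01 : ∀ j, ν (E j) = 0 ∨ ν (E j) = 1 := fun j =>
    hν.measure_eq_zero_or_one (hEm j) fun g => by
      ext y
      simp only [E, mem_preimage, mem_ofPred_eq, encard_fiber_smul]
  have hE1 : E 1 = univ := by
    refine eq_univ_of_forall fun y => ?_
    obtain ⟨x, hx⟩ := surjective_piEq G y
    simp only [E, mem_ofPred_eq, Nat.cast_one, one_le_encard_iff_nonempty]
    exact ⟨x, hx⟩
  have hE0 : E 0 = univ := eq_univ_of_forall fun y => by simp [E]
  have hex : ∃ j, ν (E j) = 0 := ⟨K, measure_setOf_le_encard_fiber_eq_zero hG ν h⟩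
  classical
  -- The sets `E j` decrease and have measure 0 or 1, so the almost sure fiber size is one less than
  -- the first index of measure 0.
  let j := Nat.find hex
  have hj : ν (E j) = 0 := Nat.find_spec hex
  have hj0 : j ≠ 0 := fun h0 => by
    rw [h0, hE0] at hj
    simp at hj
  have hj1 : j ≠ 1 := fun h0 => by
    rw [h0, hE1] at hj
    simp at hj
  have hjK : j ≤ K := Nat.find_min' hex (measure_setOf_le_encard_fiber_eq_zero hG ν h)
  refine ⟨j - 1, by omega, by omega, ν, hν, ?_⟩
  have hj' : ν (E (j - 1)) = 1 := (hE01 _).resolve_left (Nat.find_min hex (by omega))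
  have hset : {y : MaxEquicontinuousFactor G X | (piEq G ⁻¹' {y} : Set X).encard =
      ((j - 1 : ℕ) : ℕ∞)} = E (j - 1) \ E j := by
    ext y
    have hjj : ((j : ℕ) : ℕ∞) = ((j - 1 : ℕ) : ℕ∞) + 1 :=
      congrArg Nat.cast (show j = j - 1 + 1 by omega)
    simp only [E, mem_ofPred_eq, Set.mem_sdiff, hjj,
      ENat.add_one_le_iff (ENat.natCast_ne_top _), not_lt]
    exact ⟨fun h => ⟨h.ge, h.le⟩, fun h => h.2.antisymm h.1⟩
  rw [hset, measure_sdiff_null hj, hj']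

theorem isWeaklyMeanSensitiveSet_of_isOpenMap (hG : IsAmenableGroup G)
    (hopen : IsOpenMap (piEq G : X → MaxEquicontinuousFactor G X))
    (y : MaxEquicontinuousFactor G X) : IsWeaklyMeanSensitiveSet G (piEq G ⁻¹' {y} : Set X) := by
  obtain ⟨ν, hν⟩ := exists_isUniqueInvariantProbability X hG
  have := hν.1.1
  have := hν.1.2
  intro K _ x hx
  refine isWeaklyMeanSensitiveTuple_of_measure_ne_zero hG ν fun V hV => ?_
  exact measure_maxEquicontinuousFactor_ne_zero ν
    (isOpen_iInter_of_finite fun k => hopen _ (hV k).1)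
    ⟨y, mem_iInter.2 fun k => ⟨x k, (hV k).2, hx k⟩⟩

/-- By Baire, some `separatedFiberSet` has interior, and minimality moves `y` into it. Near `y` all
fibers then contain tuples with a uniform separation, so essential weakly mean-sensitive tuples lie
over points arbitrarily close to `y`, and the separation survives the limit. -/
theorem exists_essential_tuple_of_piEqAlmostToOne (hG : IsAmenableGroup G) {N : ℕ∞} {K : ℕ}
    (hK : 2 ≤ K) (hKN : (K : ℕ∞) ≤ N) (hN : PiEqAlmostToOne G X N)
    (y : MaxEquicontinuousFactor G X) :
    ∃ x : Fin K → X, (∀ k, x k ∈ (piEq G ⁻¹' {y} : Set X)) ∧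
      IsEssentialWeaklyMeanSensitiveTuple G x := by
  obtain ⟨ν, hν⟩ := exists_isUniqueInvariantProbability X hG
  have := hν.1.1
  have := hν.1.2
  obtain ⟨t, htN, htG, htd⟩ := mem_residual.1 hN
  have hsub : t ⊆ ⋃ n : ℕ, separatedFiberSet G X K (1 / ((n : ℝ) + 1)) := by
    rw [← iUnion_separatedFiberSet]
    intro w hw
    exact hKN.trans (htN hw).ge
  obtain ⟨w, hw⟩ := (htG.dense_iUnion_interior_of_closed htd
    (fun n => isClosed_separatedFiberSet _ _) hsub).nonempty
  obtain ⟨n, hn⟩ := mem_iUnion.1 hw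
  let r : ℝ := 1 / ((n : ℝ) + 1)
  have hr : 0 < r := by positivity
  let O := interior (separatedFiberSet G X K r)
  obtain ⟨g, hg⟩ := (isOpen_interior (s := separatedFiberSet G X K r)).exists_smul_mem G y ⟨w, hn⟩
  have hO : IsOpen ((g • ·) ⁻¹' O) := isOpen_interior.preimage (continuous_const_smul g)
  let S : Set (Fin K → X) := {z | ∀ i j, i ≠ j → r ≤ dist (g • z i) (g • z j)}
  have hS : IsClosed S := isClosed_setOf_le_dist_smul K r g
  have hcl := isClosed_setOf_exists_fiber (G := G)
    (hS.inter (isClosed_setOf_isWeaklyMeanSensitiveTuple G X K))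
  suffices hy : y ∈ {y : MaxEquicontinuousFactor G X |
      ∃ z ∈ S ∩ {z | IsWeaklyMeanSensitiveTuple G z}, ∀ k, piEq G (z k) = y} by
    obtain ⟨z, ⟨hz, hzw⟩, hzy⟩ := hy
    exact ⟨z, hzy, hzw, injective_of_le_dist_smul hr hz⟩
  rw [← hcl.closure_eq, mem_closure_iff_nhds_basis (closed_nhds_basis y)]
  rintro B ⟨hB, hBc⟩
  let T : Set (Fin K → X) := S ∩ ((⋂ k, {z | piEq G (z k) ∈ B}) ∩
    ⋂ k, ⋂ l, {z | piEq G (z k) = piEq G (z l)})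
  have hev : ∀ k, Continuous fun z : Fin K → X => piEq G (z k) := fun k =>
    (continuous_piEq G).comp (continuous_apply k)
  have hT : IsClosed T := hS.inter ((isClosed_iInter fun k => hBc.preimage (hev k)).inter
    (isClosed_iInter fun k => isClosed_iInter fun l => isClosed_eq (hev k) (hev l)))
  have hD : ν (interior B ∩ (g • ·) ⁻¹' O) ≠ 0 :=
    measure_maxEquicontinuousFactor_ne_zero ν (isOpen_interior.inter hO)
      ⟨y, mem_interior_iff_mem_nhds.2 hB, hg⟩
  obtain ⟨z, hz, hzw⟩ := exists_isWeaklyMeanSensitiveTuple_of_isCompact hG ν hT.isCompact hD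
    fun b hb => by
      obtain ⟨z, hzb, hz⟩ := interior_subset hb.2
      have hzb' : ∀ k, piEq G (g⁻¹ • z k) = b := fun k => by
        rw [piEq_smul, hzb, inv_smul_smul]
      refine ⟨fun k => g⁻¹ • z k, ⟨?_, ?_, ?_⟩, hzb'⟩
      · intro i j hij
        simpa using hz i j hij
      · exact mem_iInter.2 fun k => by
          change piEq G (g⁻¹ • z k) ∈ B
          rw [hzb']
          exact interior_subset hb.1
      · exact mem_iInter₂.2 fun k l => (hzb' k).trans (hzb' l).symm
  let k₀ : Fin K := ⟨0, by omega⟩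
  exact ⟨piEq G (z k₀), ⟨z, ⟨hz.1, hzw⟩, fun k => mem_iInter₂.1 hz.2.2 k k₀⟩,
    mem_iInter.1 hz.2.1 k₀⟩

/-- Given `K` ergodic measures, choose disjoint compact sets, each missing less than `1 / K` of its
measure. All the measures project to `ν_eq`, so the images of these sets intersect in positive
measure, and tuples from their product have distinct entries. -/
theorem encard_ergodicMeasures_le [MeasurableSpace X] [BorelSpace X] (hG : IsAmenableGroup G)
    {K : ℕ} (hK : 2 ≤ K) (h : ¬ ∃ x : Fin K → X, IsEssentialWeaklyMeanSensitiveTuple G x) :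
    (ergodicMeasures G X).encard ≤ ((K - 1 : ℕ) : ℕ∞) := by
  by_contra! hlt
  have hle : (K : ℕ∞) ≤ (ergodicMeasures G X).encard := by
    have h1 : (K : ℕ∞) = ((K - 1 : ℕ) : ℕ∞) + 1 :=
      congrArg Nat.cast (show K = K - 1 + 1 by omega)
    rw [h1]
    exact Order.add_one_le_of_lt hlt
  obtain ⟨μ, hμ, hμe⟩ := exists_injective_of_le_encard hle
  have hp : ∀ k, IsProbabilityMeasure (μ k) := fun k => (hμe k).1
  have he : ∀ k, ErgodicSMul G X (μ k) := fun k => (hμe k).2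
  obtain ⟨A, hAm, hA, hAd⟩ := exists_pairwise_disjoint_of_mutuallySingular μ fun i j hij =>
    (ErgodicSMul.eq_or_mutuallySingular G (μ i) (μ j)).resolve_left (hμ.ne hij)
  obtain ⟨ν, hν⟩ := exists_isUniqueInvariantProbability X hG
  have := hν.1.1
  have := hν.1.2
  have hK0 : (K : ℝ≥0∞) ≠ 0 := by
    simp only [ne_eq, Nat.cast_eq_zero]
    omega
  have hC : ∀ k, ∃ C ⊆ A k, IsCompact C ∧ μ k (A k) < μ k C + (K : ℝ≥0∞)⁻¹ := fun k =>
    (hAm k).exists_isCompact_lt_add (measure_ne_top _ _)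
      (ENNReal.inv_ne_zero.2 (ENNReal.natCast_ne_top K))
  choose C hCA hCc hCμ using hC
  have hmeas : Measurable (piEq G : X → MaxEquicontinuousFactor G X) :=
    (continuous_piEq G).measurable
  have hmap : ∀ k, (μ k).map (piEq G) = ν := fun k => by
    refine hν.2 _ (Measure.isProbabilityMeasure_map hmeas.aemeasurable) ⟨fun g s hs => ?_⟩
    rw [Measure.map_apply hmeas (measurable_const_smul g hs), Measure.map_apply hmeas hs]
    exact measure_preimage_smul_of_nullMeasurableSet (hmeas hs).nullMeasurableSet g
  have hCcl : ∀ k, MeasurableSet (piEq G '' C k) := fun k =>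
    (isClosedMap_piEq G _ (hCc k).isClosed).measurableSet
  have hCν : ∀ k, ν (piEq G '' C k)ᶜ < (K : ℝ≥0∞)⁻¹ := fun k => by
    rw [← hmap k, Measure.map_apply hmeas (hCcl k).compl]
    refine (measure_mono (?_ : _ ⊆ (C k)ᶜ)).trans_lt ?_
    · intro x hx hxC
      exact hx ⟨x, hxC, rfl⟩
    · have h1 : μ k (A k) = 1 := (prob_compl_eq_zero_iff (hAm k)).1 (hA k)
      have h2 := hCμ k
      rw [h1] at h2
      rw [prob_compl_eq_one_sub (hCc k).measurableSet]
      exact ENNReal.sub_lt_of_lt_add prob_le_one (by rwa [add_comm] at h2)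
  have hD : ν (⋂ k, piEq G '' C k) ≠ 0 := by
    intro h0
    have h1 : ν (⋂ k, piEq G '' C k)ᶜ = 1 :=
      (prob_compl_eq_one_iff (MeasurableSet.iInter hCcl)).2 h0
    have h2 : ν (⋂ k, piEq G '' C k)ᶜ < 1 := by
      rw [compl_iInter]
      calc ν (⋃ k, (piEq G '' C k)ᶜ) ≤ ∑ k, ν (piEq G '' C k)ᶜ := measure_iUnion_fintype_le _ _
        _ < ∑ _k : Fin K, (K : ℝ≥0∞)⁻¹ := by
          refine ENNReal.sum_lt_sum_of_nonempty ⟨⟨0, by omega⟩, Finset.mem_univ _⟩ fun k _ => hCν k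
        _ = 1 := by
          simp [ENNReal.mul_inv_cancel hK0 (ENNReal.natCast_ne_top K)]
    exact h2.ne h1
  obtain ⟨z, hz, hzw⟩ := exists_isWeaklyMeanSensitiveTuple_of_isCompact hG ν
    (isCompact_univ_pi hCc) hD fun y hy => by
      have h1 : ∀ k, ∃ x ∈ C k, piEq G x = y := fun k => mem_iInter.1 hy k
      choose z hz hzy using h1
      exact ⟨z, fun k _ => hz k, hzy⟩
  refine h ⟨z, hzw, fun i j hij => ?_⟩
  by_contra hne
  exact Set.disjoint_left.1 (hAd hne) (hCA i (hz i (mem_univ i)))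
    (hij ▸ hCA j (hz j (mem_univ j)))

end Main

/-- The hypothesis `hLB` is not used: an amenable group has an invariant measure on `X`, and for
minimal systems with an invariant measure every finite tuple in a fiber of `π_eq` is regionally
proximal (`mem_of_isClosed_of_fiber`), by McMahon's argument. -/
theorem mainTheorem8 {G X : Type*} [Group G] [Countable G] [Infinite G]
    [MetricSpace X] [CompactSpace X] [Nonempty X] [MeasurableSpace X] [BorelSpace X]
    [MulAction G X] [ContinuousConstSMul G X] [MulAction.IsMinimal G X]
    (hG : IsAmenableGroup G) (hLB : LocalBronstein G X) :
    (∀ K : ℕ, 2 ≤ K →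
      (¬ ∃ x : Fin K → X, IsEssentialWeaklyMeanSensitiveTuple G x) →
      ∃ K' : ℕ, 1 ≤ K' ∧ K' ≤ K - 1 ∧ PiEqRegularToOne G X (K' : ℕ∞)) ∧
    (IsOpenMap (piEq G : X → MaxEquicontinuousFactor G X) →
      ∀ y : MaxEquicontinuousFactor G X,
        IsWeaklyMeanSensitiveSet G (piEq G ⁻¹' {y} : Set X)) ∧
    (∀ (N : ℕ∞) (K : ℕ), 2 ≤ K → (K : ℕ∞) ≤ N → PiEqAlmostToOne G X N →
      ∀ y : MaxEquicontinuousFactor G X,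
        ∃ x : Fin K → X, (∀ k, x k ∈ (piEq G ⁻¹' {y} : Set X)) ∧
          IsEssentialWeaklyMeanSensitiveTuple G x) ∧
    (∀ K : ℕ, 2 ≤ K →
      (¬ ∃ x : Fin K → X, IsEssentialWeaklyMeanSensitiveTuple G x) →
      (ergodicMeasures G X).encard ≤ ((K - 1 : ℕ) : ℕ∞)) :=
  ⟨fun _ _ h => exists_piEqRegularToOne hG h,
    fun h y => isWeaklyMeanSensitiveSet_of_isOpenMap hG h y,
    fun _ _ hK hKN hN y => exists_essential_tuple_of_piEqAlmostToOne hG hK hKN hN y,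
    fun _ hK h => encard_ergodicMeasures_le hG hK h⟩
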